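/- Work in the first-order language with a binary symbol $\in$ and a unary predicate $\mathcal A$ ("is an urelement"; a set is an object that is not an urelement). $\mathrm{ZFU_R}$ is the theory with the axioms: urelements have no members, Extensionality for sets, Foundation, Pairing, Union, Powerset, Infinity, and the schemes of Separation and Replacement for formulas of this language with parameters. Collection is the scheme $$\forall w,u\,\bigl(\forall x\in w\,\exists y\,\varphi(x,y,u)\rightarrow\exists v\,\forall x\in w\,\exists y\in v\,\varphi(x,y,u)\bigr),$$ and $\mathrm{AC}_\omega$ says that every countable family of non-empty sets has a choice function. Let $U$ be a (not necessarily well-founded) model of $\mathrm{ZFU_R}+\text{Collection}+\mathrm{AC}_\omega$, equipped with its definable classes, i.e. the subsets of $U$ that are first-order definable in $U$ with parameters from $U$. A map $X\mapsto\epsilon X$ from the classes of $U$ to the objects of $U$ fulfills Basic Law V if for all classes $X,Y$: $\epsilon X=\epsilon Y\leftrightarrow\forall x\,(x\in X\leftrightarrow x\in Y)$. Such a map is definable if its graph is defined by a second-order formula $\varphi(X,y)$ without parameters (object quantifiers range over $U$, class quantifiers over the definable classes of $U$), and parametrically definable if its graph is defined by such a formula with finitely many classes and objects of $U$ as parameters.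 Then the following are equivalent: 1. $U\models$ "the urelements form a set", i.e. some set of $U$ has exactly the urelements of $U$ as its members. 2. $U$ has a definable map that fulfills Basic Law V. 3. $U$ has a parametrically definable map that fulfills Basic Law V. -/

import Mathlib

universe u

namespace UrelementSetTheory

/-- Non-logical symbols of urelement set theory: a binary membership symbol and a unary predicate
for urelements. -/
inductive UrRel : ℕ → Type
  | mem : UrRel 2
  | ur : UrRel 1

/-- The first-order language of urelement set theory. -/
def urLang : FirstOrder.Language.{0, 0} := ⟨fun _ => Empty, UrRel⟩

section Axioms

variable {M : Type u} [urLang.Structure M]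

/-- `x ∈ y` in the structure `M`. -/
def Mem (x y : M) : Prop := FirstOrder.Language.Structure.RelMap (L := urLang) UrRel.mem ![x, y]

/-- `x` is an urelement of the structure `M`. -/
def IsUr (x : M) : Prop := FirstOrder.Language.Structure.RelMap (L := urLang) UrRel.ur ![x]

/-- Sets are the objects that are not urelements. -/
def IsSet (x : M) : Prop := ¬ IsUr x

/-- First-order definability, with parameters, of a class of objects of `M`. -/
def DefinableClassOf (X : Set M) : Prop := (Set.univ : Set M).Definable₁ urLang X

/-- First-order definability, with parameters, of a binary relation on `M`. -/
def DefinableRel (R : M → M → Prop) : Prop :=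
  (Set.univ : Set M).Definable₂ urLang {p : M × M | R p.1 p.2}

/-- `z` is the empty set. -/
def IsEmptySet (z : M) : Prop := IsSet z ∧ ∀ t, ¬ Mem t z

/-- `y = x ∪ {x}`. -/
def IsSucc (x y : M) : Prop := IsSet y ∧ ∀ t, Mem t y ↔ Mem t x ∨ t = x

/-- `s` is a set that contains the empty set and is closed under `x ↦ x ∪ {x}`. -/
def IsInductive (s : M) : Prop :=
  IsSet s ∧ (∃ z, IsEmptySet z ∧ Mem z s) ∧ ∀ x, Mem x s → ∃ y, IsSucc x y ∧ Mem y s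

/-- `w` is the least inductive set `ω` of the structure. -/
def IsOmega (w : M) : Prop :=
  IsSet w ∧ ∀ n, Mem n w ↔ ∀ s, IsInductive s → Mem n s

/-- `p` is the Kuratowski ordered pair `{{a}, {a, b}}`. -/
def IsOrdPair (p a b : M) : Prop :=
  ∃ s t, (∀ z, Mem z s ↔ z = a) ∧ (∀ z, Mem z t ↔ z = a ∨ z = b) ∧
    ∀ z, Mem z p ↔ z = s ∨ z = t

/-- The ordered pair `⟨a, b⟩` is a member of `f`. -/
def PairMem (f a b : M) : Prop := ∃ p, IsOrdPair p a b ∧ Mem p f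

/-- `f` is (the graph of) a function with domain `x`. -/
def IsFunOn (f x : M) : Prop :=
  IsSet f ∧ (∀ p, Mem p f → ∃ a b, Mem a x ∧ IsOrdPair p a b) ∧
    ∀ a, Mem a x → ∃! b, PairMem f a b

/-- `x` is countable in the structure: some function in `M` injects it into `ω`. -/
def IsCountable (x : M) : Prop :=
  ∃ w f, IsOmega w ∧ IsFunOn f x ∧ (∀ a b, PairMem f a b → Mem b w) ∧
    ∀ a a' b, PairMem f a b → PairMem f a' b → a = a'

variable (M)

/-- `M` is a model of `ZFU_R`. -/
structure IsModelZFUR : Prop where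
  urelements_empty : ∀ a : M, IsUr a → ∀ z, ¬ Mem z a
  extensionality : ∀ x y : M, IsSet x → IsSet y → (∀ z, Mem z x ↔ Mem z y) → x = y
  foundation : ∀ x : M, (∃ y, Mem y x) → ∃ y, Mem y x ∧ ∀ z, Mem z y → ¬ Mem z x
  pairing : ∀ x y : M, ∃ v, IsSet v ∧ ∀ z, Mem z v ↔ z = x ∨ z = y
  union : ∀ x : M, ∃ v, IsSet v ∧ ∀ z, Mem z v ↔ ∃ y, Mem y x ∧ Mem z y
  powerset : ∀ x : M, ∃ v, IsSet v ∧ ∀ z, Mem z v ↔ IsSet z ∧ ∀ t, Mem t z → Mem t x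
  infinity : ∃ s : M, IsInductive s
  separation : ∀ X : Set M, DefinableClassOf X →
    ∀ x : M, ∃ v, IsSet v ∧ ∀ z, Mem z v ↔ Mem z x ∧ z ∈ X
  replacement : ∀ R : M → M → Prop, DefinableRel R →
    ∀ w : M, (∀ x, Mem x w → ∃! y, R x y) →
      ∃ v, IsSet v ∧ ∀ y, Mem y v ↔ ∃ x, Mem x w ∧ R x y

/-- The Collection scheme holds in `M`. -/
def Collection : Prop :=
  ∀ R : M → M → Prop, DefinableRel R →
    ∀ w : M, (∀ x, Mem x w → ∃ y, R x y) →
      ∃ v, ∀ x, Mem x w → ∃ y, Mem y v ∧ R x y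

/-- The Axiom of Countable Choice holds in `M`: every countable family of non-empty sets has a
choice function. -/
def CountableChoice : Prop :=
  ∀ x : M, IsSet x → IsCountable x → (∀ y, Mem y x → IsSet y ∧ ∃ z, Mem z y) →
    ∃ f, IsFunOn f x ∧ ∀ y z, PairMem f y z → Mem z y

/-- The urelements of `M` form a set. -/
def UrelementsFormSet : Prop := ∃ s : M, IsSet s ∧ ∀ z, Mem z s ↔ IsUr z

end Axioms

/-- Symbols for the two-sorted (second-order) language of classes, presented with a sort predicate:
membership between objects, the urelement predicate, the predicate "is a class", and membership of
an object in a class. -/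
inductive ClassRel : ℕ → Type
  | mem : ClassRel 2
  | ur : ClassRel 1
  | isClass : ClassRel 1
  | memClass : ClassRel 2

/-- The second-order language of urelement set theory. -/
def classLang : FirstOrder.Language.{0, 0} := ⟨fun _ => Empty, ClassRel⟩

section Classes

variable (M : Type u) [urLang.Structure M]

/-- The classes of `M`: subsets first-order definable in `M` with parameters from `M`. -/
def DefClass : Type u := {X : Set M // DefinableClassOf X}

/-- `M` equipped with its definable classes: objects are `Sum.inl x`, classes are `Sum.inr X`. -/
abbrev WithClasses : Type u := M ⊕ DefClass M

/-- Quantifiers of `classLang` range over all objects and all definable classes; the sort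
predicate `isClass` restricts them to either sort. -/
instance : classLang.Structure (WithClasses M) where
  funMap := fun f => nomatch f
  RelMap := fun r => match r with
    | ClassRel.mem => fun v => ∃ x y : M, v 0 = Sum.inl x ∧ v 1 = Sum.inl y ∧ Mem x y
    | ClassRel.ur => fun v => ∃ x : M, v 0 = Sum.inl x ∧ IsUr x
    | ClassRel.isClass => fun v => ∃ X : DefClass M, v 0 = Sum.inr X
    | ClassRel.memClass => fun v =>
        ∃ (x : M) (X : DefClass M), v 0 = Sum.inl x ∧ v 1 = Sum.inr X ∧ x ∈ X.1

variable {M}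

/-- The graph of a map from classes to objects. -/
def graphOf (ε : DefClass M → M) : Set (WithClasses M × WithClasses M) :=
  {p | ∃ X : DefClass M, p = (Sum.inr X, Sum.inl (ε X))}

/-- The map is defined by a second-order formula `φ(X, y)` without parameters. -/
def IsDefinableMap (ε : DefClass M → M) : Prop :=
  (∅ : Set (WithClasses M)).Definable₂ classLang (graphOf ε)

/-- The map is defined by a second-order formula `φ(X, y, P₁, …, Pₙ)` with parameters, which may be
classes or objects. -/
def IsParamDefinableMap (ε : DefClass M → M) : Prop :=
  (Set.univ : Set (WithClasses M)).Definable₂ classLang (graphOf ε)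

/-- The map fulfills Basic Law V. -/
def FulfillsBLV (ε : DefClass M → M) : Prop :=
  ∀ X Y : DefClass M, ε X = ε Y ↔ ∀ x : M, x ∈ X.1 ↔ x ∈ Y.1

end Classes

end UrelementSetTheory

open UrelementSetTheory

/-!
Both nontrivial implications rest on a calculus of definability. A predicate on a type of
assignments (`Ctx`) is `FODef` if a first-order formula in the variables of the context expresses
it, and a function is `FOTerm` if its graph is `FODef`; `SODef` adds quantifiers over definable
classes. `FODef` and `FOTerm` are type classes whose closure properties are instances, so that
definability of a concrete predicate is found by instance search, both with parameters (`FOBase`)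
and without (`SOBase`). `FODef.definableClass` and `SODef.isDefinableMap` connect the calculus to
definability by formulas. Set-theoretic operations are functions on `M`, most of them given by the
comprehension operator `theSet`.

**If the urelements form a set.** The cumulative hierarchy over the set of urelements assigns a
level to every object (`level`), and Scott's trick selects from every nonempty definable class the
nonempty set of its members of least level (`small_least_level`). Each definable class is given by
a formula and parameters, and both are coded by an object `p` of the model, whose level as a code
is a natural number of the model that bounds the depth of the formula. Satisfaction for codes up to
level `n` is decided by a class that is unique if it exists (`IsSatBelow.unique`) and that exists
for standard `n` (`exists_isSatBelow`). The abstract of `Y` is `⟨n, c⟩`, where `n ∈ ω` is least such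
that this class exists for `n` and some code of level `n` defines `Y`, and `c` is the set of such
codes of least rank (`IsAbstract`). Nothing has to be known about nonstandard levels: every
definable class is defined at some standard level (`exists_defines`), and whatever lies below a
standard number is standard.

**If the urelements do not form a set.** Let `ε` be parametrically definable and fulfill Basic
Law V. An involution `π` of the urelements extends to an automorphism, and if `π` fixes a certain
set `s` of urelements, which supports the parameters, then `π (ε X) = ε (π X)`
(`exists_forall_ext_eq`). Hence, by Basic Law V, such a `π` fixes the object `ε X` if and only if it
fixes the class `X`. Collection and countable choice give two injections `f`, `f'` of `ω` into the
urelements outside `s` with disjoint ranges (`exists_injOutside_omega`). Let `X` be the class of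
all `x` that contain `f m` for all but boundedly many `m` (`tailClass`). All transpositions of
urelements outside `s` fix `X`, so they fix `ε X`; as there are always urelements outside a given
set, all urelements in the transitive closure of `ε X` belong to `s`
(`exists_trans_of_forall_transposition`). Then the involution that swaps `f m` and `f' m` fixes
`ε X`, and so it fixes `X`. But it moves the range of `f`, which belongs to `X`, to the range of
`f'`, which does not.
-/

/-! ### First-order and second-order definability over contexts -/

namespace UrelementSetTheory

open FirstOrder Set

/-- A context: a type of assignments together with the object variables and the class variables
that first-order formulas over it may mention. -/
class Ctx (M : outParam (Type u)) (Γ : Type u) where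
  obj : Set (Γ → M)
  cls : Set (Γ → Set M)

/-- The context with no variables in which all objects and all definable classes are available
as parameters. -/
inductive FOBase (M : Type u) : Type u
  | nil

/-- The context with neither variables nor parameters. -/
inductive SOBase (M : Type u) : Type u
  | nil

section Contexts

variable {M : Type u} [urLang.Structure M] {Γ : Type u}

/-- The variables of a context in which everything is a parameter are the constant functions. -/
instance : Ctx M (FOBase M) where
  obj := {o | ∃ m, o = fun _ => m}
  cls := {c | ∃ X, DefinableClassOf X ∧ c = fun _ => X}

instance : Ctx M (SOBase M) where
  obj := ∅
  cls := ∅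

instance instCtxProd [Ctx M Γ] : Ctx M (Γ × M) where
  obj := {o | (∃ o' ∈ Ctx.obj (Γ := Γ), o = fun p => o' p.1) ∨ o = fun p => p.2}
  cls := {c | ∃ c' ∈ Ctx.cls (Γ := Γ), c = fun p => c' p.1}

instance instCtxProdClass [Ctx M Γ] : Ctx M (Γ × DefClass M) where
  obj := {o | ∃ o' ∈ Ctx.obj (Γ := Γ), o = fun p => o' p.1}
  cls := {c | (∃ c' ∈ Ctx.cls (Γ := Γ), c = fun p => c' p.1) ∨ c = fun p => p.2.1}

/-- Contexts in which all objects and all definable classes are available as parameters. -/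
class FOCtx (M : outParam (Type u)) [urLang.Structure M] (Γ : Type u) [Ctx M Γ] : Prop where
  const_obj : ∀ m : M, (fun _ => m) ∈ Ctx.obj (Γ := Γ)
  const_cls : ∀ X : Set M, DefinableClassOf X → (fun _ => X) ∈ Ctx.cls (Γ := Γ)

instance : FOCtx M (FOBase M) := ⟨fun m => ⟨m, rfl⟩, fun X h => ⟨X, h, rfl⟩⟩

instance [Ctx M Γ] [FOCtx M Γ] : FOCtx M (Γ × M) :=
  ⟨fun m => Or.inl ⟨_, FOCtx.const_obj m, rfl⟩, fun X h => ⟨_, FOCtx.const_cls X h, rfl⟩⟩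

/-- `FODef P`: the predicate `P` on assignments is given by a first-order formula whose atoms
mention only the variables of the context. -/
class inductive FODef {M : Type u} [urLang.Structure M] :
    ∀ {Γ : Type u} [Ctx M Γ], (Γ → Prop) → Prop
  | mem' {Γ : Type u} [Ctx M Γ] {s t : Γ → M} (hs : s ∈ Ctx.obj (Γ := Γ))
      (ht : t ∈ Ctx.obj (Γ := Γ)) : FODef fun γ => Mem (s γ) (t γ)
  | eq' {Γ : Type u} [Ctx M Γ] {s t : Γ → M} (hs : s ∈ Ctx.obj (Γ := Γ))
      (ht : t ∈ Ctx.obj (Γ := Γ)) : FODef fun γ => s γ = t γ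
  | ur' {Γ : Type u} [Ctx M Γ] {s : Γ → M} (hs : s ∈ Ctx.obj (Γ := Γ)) :
      FODef fun γ => IsUr (s γ)
  | cls' {Γ : Type u} [Ctx M Γ] {s : Γ → M} {c : Γ → Set M} (hs : s ∈ Ctx.obj (Γ := Γ))
      (hc : c ∈ Ctx.cls (Γ := Γ)) : FODef fun γ => s γ ∈ c γ
  | not' {Γ : Type u} [Ctx M Γ] {P : Γ → Prop} (hP : FODef P) : FODef fun γ => ¬ P γ
  | and' {Γ : Type u} [Ctx M Γ] {P Q : Γ → Prop} (hP : FODef P) (hQ : FODef Q) :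
      FODef fun γ => P γ ∧ Q γ
  | ex' {Γ : Type u} [Ctx M Γ] {P : Γ × M → Prop} (hP : FODef P) : FODef fun γ => ∃ x, P (γ, x)

/-- The function `t` from assignments to objects has a first-order definable graph. -/
class FOTerm [Ctx M Γ] (t : Γ → M) : Prop where
  graph : FODef fun p : Γ × M => t p.1 = p.2

/-- `SODef P`: the predicate `P` on assignments is given by a formula that quantifies over objects
and over definable classes. -/
inductive SODef {M : Type u} [urLang.Structure M] : ∀ {Γ : Type u} [Ctx M Γ], (Γ → Prop) → Prop
  | fo {Γ : Type u} [Ctx M Γ] {P : Γ → Prop} (hP : FODef P) : SODef P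
  | not {Γ : Type u} [Ctx M Γ] {P : Γ → Prop} (hP : SODef P) : SODef fun γ => ¬ P γ
  | and {Γ : Type u} [Ctx M Γ] {P Q : Γ → Prop} (hP : SODef P) (hQ : SODef Q) :
      SODef fun γ => P γ ∧ Q γ
  | ex {Γ : Type u} [Ctx M Γ] {P : Γ × M → Prop} (hP : SODef P) : SODef fun γ => ∃ x, P (γ, x)
  | exClass {Γ : Type u} [Ctx M Γ] {P : Γ × DefClass M → Prop} (hP : SODef P) :
      SODef fun γ => ∃ X, P (γ, X)

theorem FODef.subst [Ctx M Γ] {P : Γ → Prop} (h : FODef P) :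
    ∀ {Δ : Type u} [Ctx M Δ] (σ : Δ → Γ),
      (∀ o ∈ Ctx.obj (Γ := Γ), (fun δ => o (σ δ)) ∈ Ctx.obj (Γ := Δ)) →
      (∀ c ∈ Ctx.cls (Γ := Γ), (fun δ => c (σ δ)) ∈ Ctx.cls (Γ := Δ)) →
      FODef fun δ => P (σ δ) := by
  induction h with
  | mem' hs ht => intro Δ _ σ h₁ _; exact .mem' (h₁ _ hs) (h₁ _ ht)
  | eq' hs ht => intro Δ _ σ h₁ _; exact .eq' (h₁ _ hs) (h₁ _ ht)
  | ur' hs => intro Δ _ σ h₁ _; exact .ur' (h₁ _ hs)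
  | cls' hs hc => intro Δ _ σ h₁ h₂; exact .cls' (h₁ _ hs) (h₂ _ hc)
  | not' _ ih => intro Δ _ σ h₁ h₂; exact .not' (ih σ h₁ h₂)
  | and' _ _ ih₁ ih₂ => intro Δ _ σ h₁ h₂; exact .and' (ih₁ σ h₁ h₂) (ih₂ σ h₁ h₂)
  | ex' _ ih =>
    intro Δ _ σ h₁ h₂
    refine .ex' (ih (fun p : Δ × M => (σ p.1, p.2)) ?_ ?_)
    · rintro o (⟨o', ho', rfl⟩ | rfl)
      · exact Or.inl ⟨_, h₁ _ ho', rfl⟩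
      · exact Or.inr rfl
    · rintro c ⟨c', hc', rfl⟩
      exact ⟨_, h₂ _ hc', rfl⟩

variable [Ctx M Γ]

theorem FODef.weaken {P : Γ → Prop} (h : FODef P) : FODef fun p : Γ × M => P p.1 :=
  h.subst _ (fun o ho => Or.inl ⟨o, ho, rfl⟩) fun c hc => ⟨c, hc, rfl⟩

theorem FOTerm.of_obj {t : Γ → M} (h : t ∈ Ctx.obj (Γ := Γ)) : FOTerm t :=
  ⟨.eq' (Or.inl ⟨t, h, rfl⟩) (Or.inr rfl)⟩

theorem FODef.comp {P : Γ × M → Prop} (h : FODef P) {t : Γ → M} (ht : FOTerm t) :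
    FODef fun γ => P (γ, t γ) := by
  have : FODef fun γ => ∃ x, t γ = x ∧ P (γ, x) := .ex' (.and' ht.graph h)
  simpa using this

theorem FOTerm.weaken' {t : Γ → M} (h : FOTerm t) : FOTerm fun p : Γ × M => t p.1 := by
  refine ⟨h.graph.subst (fun p : (Γ × M) × M => (p.1.1, p.2)) ?_ ?_⟩
  · rintro o (⟨o', ho', rfl⟩ | rfl)
    · exact Or.inl ⟨_, Or.inl ⟨o', ho', rfl⟩, rfl⟩
    · exact Or.inr rfl
  · rintro c ⟨c', hc', rfl⟩
    exact ⟨_, ⟨c', hc', rfl⟩, rfl⟩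

theorem FOTerm.weakenClass' {t : Γ → M} (h : FOTerm t) :
    FOTerm fun p : Γ × DefClass M => t p.1 := by
  refine ⟨h.graph.subst (fun p : (Γ × DefClass M) × M => (p.1.1, p.2)) ?_ ?_⟩
  · rintro o (⟨o', ho', rfl⟩ | rfl)
    · exact Or.inl ⟨_, ⟨o', ho', rfl⟩, rfl⟩
    · exact Or.inr rfl
  · rintro c ⟨c', hc', rfl⟩
    exact ⟨_, Or.inl ⟨c', hc', rfl⟩, rfl⟩

/-- The class-valued function `X` on assignments has a first-order definable membership
relation. -/
class FOClass (X : Γ → Set M) : Prop where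
  mem : FODef fun p : Γ × M => p.2 ∈ X p.1

theorem FOClass.of_cls {X : Γ → Set M} (h : X ∈ Ctx.cls (Γ := Γ)) : FOClass X :=
  ⟨.cls' (Or.inr rfl) ⟨X, h, rfl⟩⟩

-- Variables and weakening. Unification does not solve `?t p.1 = p.1.1.2`, so every depth that
-- occurs needs an instance of its own.

instance FOTerm.v0 : FOTerm fun p : Γ × M => p.2 := .of_obj (Or.inr rfl)
instance (priority := 900) FOTerm.w1 {t : Γ → M} [h : FOTerm t] :
    FOTerm fun p : Γ × M => t p.1 := h.weaken'
instance FOTerm.v1 : FOTerm fun p : (Γ × M) × M => p.1.2 := FOTerm.v0.weaken'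
instance (priority := 900) FOTerm.w2 {t : Γ → M} [h : FOTerm t] :
    FOTerm fun p : (Γ × M) × M => t p.1.1 := h.weaken'.weaken'
instance FOTerm.v2 : FOTerm fun p : ((Γ × M) × M) × M => p.1.1.2 := FOTerm.v1.weaken'
instance (priority := 900) FOTerm.w3 {t : Γ → M} [h : FOTerm t] :
    FOTerm fun p : ((Γ × M) × M) × M => t p.1.1.1 := h.weaken'.weaken'.weaken'
instance FOTerm.v3 : FOTerm fun p : (((Γ × M) × M) × M) × M => p.1.1.1.2 := FOTerm.v2.weaken'
instance (priority := 900) FOTerm.w4 {t : Γ → M} [h : FOTerm t] :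
    FOTerm fun p : (((Γ × M) × M) × M) × M => t p.1.1.1.1 := h.weaken'.weaken'.weaken'.weaken'
instance (priority := 900) FOTerm.wc {t : Γ → M} [h : FOTerm t] :
    FOTerm fun p : Γ × DefClass M => t p.1 := h.weakenClass'

instance (priority := 1100) FOTerm.const [FOCtx M Γ] (m : M) : FOTerm fun _ : Γ => m :=
  .of_obj (FOCtx.const_obj m)

instance FOClass.v0 : FOClass fun p : Γ × DefClass M => p.2.1 := .of_cls (Or.inr rfl)
instance (priority := 1100) FOClass.const [FOCtx M Γ] (X : DefClass M) :
    FOClass fun _ : Γ => X.1 :=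
  .of_cls (FOCtx.const_cls X.1 X.2)

theorem FOClass.weaken' {X : Γ → Set M} (h : FOClass X) : FOClass fun p : Γ × M => X p.1 := by
  refine ⟨h.mem.subst (fun p : (Γ × M) × M => (p.1.1, p.2)) ?_ ?_⟩
  · rintro o (⟨o', ho', rfl⟩ | rfl)
    · exact Or.inl ⟨_, Or.inl ⟨o', ho', rfl⟩, rfl⟩
    · exact Or.inr rfl
  · rintro c ⟨c', hc', rfl⟩
    exact ⟨_, ⟨c', hc', rfl⟩, rfl⟩

theorem FOClass.weakenClass' {X : Γ → Set M} (h : FOClass X) :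
    FOClass fun p : Γ × DefClass M => X p.1 := by
  refine ⟨h.mem.subst (fun p : (Γ × DefClass M) × M => (p.1.1, p.2)) ?_ ?_⟩
  · rintro o (⟨o', ho', rfl⟩ | rfl)
    · exact Or.inl ⟨_, ⟨o', ho', rfl⟩, rfl⟩
    · exact Or.inr rfl
  · rintro c ⟨c', hc', rfl⟩
    exact ⟨_, Or.inl ⟨c', hc', rfl⟩, rfl⟩

instance (priority := 900) FOClass.w1 {X : Γ → Set M} [h : FOClass X] :
    FOClass fun p : Γ × M => X p.1 := h.weaken'
instance (priority := 900) FOClass.w2 {X : Γ → Set M} [h : FOClass X] :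
    FOClass fun p : (Γ × M) × M => X p.1.1 := h.weaken'.weaken'
instance (priority := 900) FOClass.w4 {X : Γ → Set M} [h : FOClass X] :
    FOClass fun p : (((Γ × M) × M) × M) × M => X p.1.1.1.1 := h.weaken'.weaken'.weaken'.weaken'
instance (priority := 900) FOClass.w3 {X : Γ → Set M} [h : FOClass X] :
    FOClass fun p : ((Γ × M) × M) × M => X p.1.1.1 := h.weaken'.weaken'.weaken'
section Closure

variable {s t : Γ → M} {P Q : Γ → Prop}

instance FODef.notI [hP : FODef P] : FODef fun γ => ¬ P γ := .not' hP
instance FODef.andI [hP : FODef P] [hQ : FODef Q] : FODef fun γ => P γ ∧ Q γ := .and' hP hQ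
instance FODef.exI {P : Γ → M → Prop} [hP : FODef fun p : Γ × M => P p.1 p.2] :
    FODef fun γ => ∃ x, P γ x := .ex' hP
instance FODef.orI [hP : FODef P] [hQ : FODef Q] : FODef fun γ => P γ ∨ Q γ := by
  have : FODef fun γ => ¬ (¬ P γ ∧ ¬ Q γ) := inferInstance
  simpa only [not_and_or, not_not] using this
instance FODef.impI [hP : FODef P] [hQ : FODef Q] : FODef fun γ => P γ → Q γ := by
  have : FODef fun γ => ¬ (P γ ∧ ¬ Q γ) := inferInstance
  simpa only [not_and, not_not] using this
instance FODef.iffI [hP : FODef P] [hQ : FODef Q] : FODef fun γ => P γ ↔ Q γ := by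
  have : FODef fun γ => (P γ → Q γ) ∧ (Q γ → P γ) := inferInstance
  simpa only [iff_def] using this
instance FODef.allI {P : Γ → M → Prop} [hP : FODef fun p : Γ × M => P p.1 p.2] :
    FODef fun γ => ∀ x, P γ x := by
  have : FODef fun γ => ¬ ∃ x, ¬ P γ x := inferInstance
  simpa only [not_exists, not_not] using this

instance FODef.memI [hs : FOTerm s] [ht : FOTerm t] : FODef fun γ => Mem (s γ) (t γ) := by
  exact FODef.comp (P := fun p => Mem (s p.1) p.2)
    (FODef.comp (P := fun p : (Γ × M) × M => Mem p.2 p.1.2)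
      (t := fun p => s p.1) (.mem' (Or.inr rfl) (Or.inl ⟨_, Or.inr rfl, rfl⟩)) inferInstance) ht
instance FODef.eqI [hs : FOTerm s] [ht : FOTerm t] : FODef fun γ => s γ = t γ :=
  FODef.comp (P := fun p => s p.1 = p.2) hs.graph ht
instance FODef.urI [hs : FOTerm s] : FODef fun γ => IsUr (s γ) :=
  FODef.comp (P := fun p => IsUr p.2) (.ur' (Or.inr rfl)) hs
instance FODef.clsI {X : Γ → Set M} [hs : FOTerm s] [hX : FOClass X] :
    FODef fun γ => s γ ∈ X γ :=
  FODef.comp (P := fun p => p.2 ∈ X p.1) hX.mem hs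
instance FODef.setI [hs : FOTerm s] : FODef fun γ => IsSet (s γ) := by
  unfold IsSet; infer_instance

end Closure

/-- A predicate with parameters may be applied to definable terms of any context with
parameters. -/
theorem FODef.pred {P : M → Prop} (h : FODef fun p : FOBase M × M => P p.2) {Γ : Type u} [Ctx M Γ]
    [FOCtx M Γ] (t : Γ → M) [ht : FOTerm t] : FODef fun γ => P (t γ) := by
  refine FODef.comp (P := fun p : Γ × M => P p.2)
    (h.subst (fun p : Γ × M => (.nil, p.2)) ?_ ?_) ht
  · rintro o (⟨o', ⟨m, rfl⟩, rfl⟩ | rfl)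
    · exact FOCtx.const_obj m
    · exact Or.inr rfl
  · rintro c ⟨c', ⟨X, hX, rfl⟩, rfl⟩
    exact FOCtx.const_cls X hX

/-- Binary version of `FODef.pred`. -/
theorem FODef.pred₂ {P : M → M → Prop} (h : FODef fun p : (FOBase M × M) × M => P p.1.2 p.2)
    {Γ : Type u} [Ctx M Γ] [FOCtx M Γ] (s t : Γ → M) [hs : FOTerm s] [ht : FOTerm t] :
    FODef fun γ => P (s γ) (t γ) := by
  refine FODef.comp (P := fun p : Γ × M => P (s p.1) p.2)
    (FODef.comp (P := fun p : (Γ × M) × M => P p.2 p.1.2) (t := fun p => s p.1)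
      (h.subst (fun p : (Γ × M) × M => ((.nil, p.2), p.1.2)) ?_ ?_) inferInstance) ht
  · rintro o (⟨o', (⟨o'', ⟨m, rfl⟩, rfl⟩ | rfl), rfl⟩ | rfl)
    · exact FOCtx.const_obj m
    · exact Or.inr rfl
    · exact Or.inl ⟨_, Or.inr rfl, rfl⟩
  · rintro c ⟨c', ⟨c'', ⟨X, hX, rfl⟩, rfl⟩, rfl⟩
    exact FOCtx.const_cls X hX

/-- Ternary version of `FODef.pred`. -/
theorem FODef.pred₃ {P : M → M → M → Prop}
    (h : FODef fun p : ((FOBase M × M) × M) × M => P p.1.1.2 p.1.2 p.2)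
    {Γ : Type u} [Ctx M Γ] [FOCtx M Γ] (r s t : Γ → M) [hr : FOTerm r] [hs : FOTerm s]
    [ht : FOTerm t] : FODef fun γ => P (r γ) (s γ) (t γ) := by
  have key : FODef fun p : ((Γ × M) × M) × M => P p.1.1.2 p.1.2 p.2 := by
    refine h.subst (fun p : ((Γ × M) × M) × M => (((.nil, p.1.1.2), p.1.2), p.2)) ?_ ?_
    · rintro o (⟨o', (⟨o'', (⟨o₃, ⟨m, rfl⟩, rfl⟩ | rfl), rfl⟩ | rfl), rfl⟩ | rfl)
      · exact FOCtx.const_obj m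
      · exact Or.inl ⟨_, Or.inl ⟨_, Or.inr rfl, rfl⟩, rfl⟩
      · exact Or.inl ⟨_, Or.inr rfl, rfl⟩
      · exact Or.inr rfl
    · rintro c ⟨c', ⟨c'', ⟨c₃, ⟨X, hX, rfl⟩, rfl⟩, rfl⟩, rfl⟩
      exact FOCtx.const_cls X hX
  have : FODef fun γ => ∃ x y z, r γ = x ∧ s γ = y ∧ t γ = z ∧ P x y z := by
    refine @FODef.exI _ _ _ _ _ (@FODef.exI _ _ _ _ _ (@FODef.exI _ _ _ _ _ ?_))
    exact .and' inferInstance (.and' inferInstance (.and' inferInstance key))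
  simpa using this

theorem FOTerm.fn {F : M → M} (h : FOTerm fun p : FOBase M × M => F p.2) {Γ : Type u} [Ctx M Γ]
    [FOCtx M Γ] (t : Γ → M) [ht : FOTerm t] : FOTerm fun γ => F (t γ) :=
  ⟨FODef.pred₂ (P := fun x y => F x = y) h.graph (fun p : Γ × M => t p.1) (fun p => p.2)⟩

theorem FOTerm.fn₂ {F : M → M → M} (h : FOTerm fun p : (FOBase M × M) × M => F p.1.2 p.2)
    {Γ : Type u} [Ctx M Γ] [FOCtx M Γ] (s t : Γ → M) [hs : FOTerm s] [ht : FOTerm t] :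
    FOTerm fun γ => F (s γ) (t γ) :=
  ⟨FODef.pred₃ (P := fun x y z => F x y = z) h.graph (fun p : Γ × M => s p.1)
    (fun p : Γ × M => t p.1) (fun p => p.2)⟩

end Contexts

end UrelementSetTheory

/-! ### From contexts to formulas -/

namespace UrelementSetTheory

open FirstOrder Set

section Translation

theorem definable_relMap_terms {L : FirstOrder.Language.{0, 0}} {N : Type u} [L.Structure N]
    (A : Set N) {n k : ℕ} (R : L.Relations k) (τ : Fin k → L[[A]].Term (Fin n)) :
    A.Definable L {v : Fin n → N | Language.Structure.RelMap R fun j => (τ j).realize v} := by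
  refine ⟨Language.Relations.formula (L := L[[A]]) (Sum.inl R) τ, ?_⟩
  ext v
  exact (Language.Formula.realize_rel (L := L[[A]]) (M := N) (R := Sum.inl R) (ts := τ)).symm

theorem definable_relMap {L : FirstOrder.Language.{0, 0}} {N : Type u} [L.Structure N]
    (A : Set N) {n k : ℕ} (R : L.Relations k) (i : Fin k → Fin n) :
    A.Definable L {v : Fin n → N | Language.Structure.RelMap R fun j => v (i j)} := by
  refine (Definable.mono ?_ (Set.empty_subset A))
  rw [empty_definable_iff]
  exact ⟨R.formula fun j => .var (i j), by ext v; simp [Language.Formula.realize_rel]⟩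

theorem definable_coord_eq {L : FirstOrder.Language.{0, 0}} {N : Type u} [L.Structure N]
    (A : Set N) {n : ℕ} (i j : Fin n) : A.Definable L {v : Fin n → N | v i = v j} := by
  refine (Definable.mono ?_ (Set.empty_subset A))
  rw [empty_definable_iff]
  exact ⟨Language.Term.equal (.var i) (.var j), by ext v; simp⟩

theorem definable_exists_snoc {L : FirstOrder.Language.{0, 0}} {N : Type u} [L.Structure N]
    {A : Set N} {n : ℕ} {S : Set (Fin (n + 1) → N)} (hS : A.Definable L S) :
    A.Definable L {v : Fin n → N | ∃ z, (Fin.snoc v z : Fin (n + 1) → N) ∈ S} := by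
  convert hS.image_comp (Fin.castSucc : Fin n → Fin (n + 1)) using 1
  ext v
  constructor
  · rintro ⟨z, hz⟩
    exact ⟨_, hz, by ext i; simp⟩
  · rintro ⟨w, hw, rfl⟩
    refine ⟨w (Fin.last n), ?_⟩
    convert hw
    exact Fin.snoc_init_self w

variable {M : Type u} [urLang.Structure M] {Γ : Type u}

/-- A first-order predicate is definable with parameters once the assignments are presented by
finite tuples whose entries, together with parameters, serve as the variables. -/
theorem FODef.definable_tuple [Ctx M Γ] {P : Γ → Prop} (h : FODef P) :
    ∀ (n : ℕ) (ι : (Fin n → M) → Γ),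
      (∀ o ∈ Ctx.obj (Γ := Γ), (∃ i, ∀ v, o (ι v) = v i) ∨ ∃ m, ∀ v, o (ι v) = m) →
      (∀ c ∈ Ctx.cls (Γ := Γ), ∃ X, DefinableClassOf X ∧ ∀ v, c (ι v) = X) →
      (univ : Set M).Definable urLang {v | P (ι v)} := by
  have term : ∀ {Γ : Type u} [Ctx M Γ] (n : ℕ) (ι : (Fin n → M) → Γ) (o : Γ → M),
      ((∃ i, ∀ v, o (ι v) = v i) ∨ ∃ m, ∀ v, o (ι v) = m) →
      ∃ τ : (urLang[[(univ : Set M)]]).Term (Fin n), ∀ v, τ.realize v = o (ι v) := by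
    rintro Γ _ n ι o (⟨i, hi⟩ | ⟨m, hm⟩)
    · exact ⟨.var i, fun v => (hi v).symm⟩
    · exact ⟨(urLang.con (⟨m, trivial⟩ : (univ : Set M))).term, fun v => by simp [hm]⟩
  induction h with
  | mem' hs ht =>
    intro n ι ho _
    obtain ⟨σ, hσ⟩ := term n ι _ (ho _ hs)
    obtain ⟨τ, hτ⟩ := term n ι _ (ho _ ht)
    convert definable_relMap_terms (L := urLang) univ UrRel.mem ![σ, τ] using 3 with v
    beta_reduce
    rw [← hσ, ← hτ, Mem]
    congr! 1
    ext j; fin_cases j <;> rfl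
  | eq' hs ht =>
    intro n ι ho _
    obtain ⟨σ, hσ⟩ := term n ι _ (ho _ hs)
    obtain ⟨τ, hτ⟩ := term n ι _ (ho _ ht)
    refine ⟨Language.Term.equal σ τ, ?_⟩
    ext v
    simp [hσ, hτ]
  | ur' hs =>
    intro n ι ho _
    obtain ⟨σ, hσ⟩ := term n ι _ (ho _ hs)
    convert definable_relMap_terms (L := urLang) univ UrRel.ur ![σ] using 3 with v
    beta_reduce
    rw [← hσ, IsUr]
    congr! 1
    ext j; fin_cases j; rfl
  | cls' hs hc =>
    intro n ι ho hc'
    obtain ⟨X, hX, hXv⟩ := hc' _ hc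
    simp only [hXv]
    obtain ⟨i, hi⟩ | ⟨m, hm⟩ := ho _ hs
    · simp only [hi]
      exact Definable.preimage_comp (fun _ : Fin 1 => i) hX
    · simp only [hm]
      by_cases hmX : m ∈ X <;> simp [hmX]
  | not' _ ih => intro n ι ho hc; exact (ih n ι ho hc).compl
  | and' _ _ ih₁ ih₂ => intro n ι ho hc; exact (ih₁ n ι ho hc).inter (ih₂ n ι ho hc)
  | @ex' Γ _ P _ ih =>
    intro n ι ho hc
    have := ih (n + 1) (fun v => (ι (Fin.init v), v (Fin.last n))) ?_ ?_
    · convert definable_exists_snoc this using 3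
      simp
    · rintro o (⟨o', ho', rfl⟩ | rfl)
      · obtain ⟨i, hi⟩ | ⟨m, hm⟩ := ho _ ho'
        · exact Or.inl ⟨i.castSucc, fun v => hi _⟩
        · exact Or.inr ⟨m, fun v => hm _⟩
      · exact Or.inl ⟨Fin.last n, fun v => rfl⟩
    · rintro c ⟨c', hc', rfl⟩
      obtain ⟨X, hX, h⟩ := hc _ hc'
      exact ⟨X, hX, fun v => h _⟩

theorem FODef.definableClass {P : M → Prop} (h : FODef fun p : FOBase M × M => P p.2) :
    DefinableClassOf {x | P x} := by
  refine h.definable_tuple 1 (fun v => (.nil, v 0)) ?_ ?_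
  · rintro o (⟨o', ⟨m, rfl⟩, rfl⟩ | rfl)
    · exact Or.inr ⟨m, fun _ => rfl⟩
    · exact Or.inl ⟨0, fun _ => rfl⟩
  · rintro c ⟨c', ⟨X, hX, rfl⟩, rfl⟩
    exact ⟨X, hX, fun _ => rfl⟩

theorem FODef.definableRel {R : M → M → Prop}
    (h : FODef fun p : (FOBase M × M) × M => R p.1.2 p.2) : DefinableRel R := by
  refine h.definable_tuple 2 (fun v => ((.nil, v 0), v 1)) ?_ ?_
  · rintro o (⟨o', (⟨o'', ⟨m, rfl⟩, rfl⟩ | rfl), rfl⟩ | rfl)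
    · exact Or.inr ⟨m, fun _ => rfl⟩
    · exact Or.inl ⟨0, fun _ => rfl⟩
    · exact Or.inl ⟨1, fun _ => rfl⟩
  · rintro c ⟨c', ⟨c'', ⟨X, hX, rfl⟩, rfl⟩, rfl⟩
    exact ⟨X, hX, fun _ => rfl⟩

/-- How a context is presented by tuples of objects and classes: every variable is an entry of
the tuple. -/
def TuplePresentation [Ctx M Γ] (n : ℕ) (ι : Γ → Fin n → WithClasses M) : Prop :=
  (∀ o ∈ Ctx.obj (Γ := Γ), ∃ i, ∀ γ, ι γ i = Sum.inl (o γ)) ∧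
    ∀ c ∈ Ctx.cls (Γ := Γ), ∃ i, ∀ γ, ∃ X : DefClass M, ι γ i = Sum.inr X ∧ X.1 = c γ

theorem TuplePresentation.snoc_obj [Ctx M Γ] {n : ℕ} {ι : Γ → Fin n → WithClasses M}
    (h : TuplePresentation n ι) :
    TuplePresentation (n + 1) fun p : Γ × M => Fin.snoc (ι p.1) (Sum.inl p.2) := by
  constructor
  · rintro o (⟨o', ho', rfl⟩ | rfl)
    · obtain ⟨i, hi⟩ := h.1 _ ho'
      exact ⟨i.castSucc, fun γ => by simp [hi]⟩
    · exact ⟨Fin.last n, fun γ => by simp⟩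
  · rintro c ⟨c', hc', rfl⟩
    obtain ⟨i, hi⟩ := h.2 _ hc'
    exact ⟨i.castSucc, fun γ => by simpa using hi γ.1⟩

theorem TuplePresentation.snoc_cls [Ctx M Γ] {n : ℕ} {ι : Γ → Fin n → WithClasses M}
    (h : TuplePresentation n ι) :
    TuplePresentation (n + 1) fun p : Γ × DefClass M => Fin.snoc (ι p.1) (Sum.inr p.2) := by
  constructor
  · rintro o ⟨o', ho', rfl⟩
    obtain ⟨i, hi⟩ := h.1 _ ho'
    exact ⟨i.castSucc, fun γ => by simp [hi]⟩
  · rintro c (⟨c', hc', rfl⟩ | rfl)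
    · obtain ⟨i, hi⟩ := h.2 _ hc'
      exact ⟨i.castSucc, fun γ => by simpa using hi γ.1⟩
    · exact ⟨Fin.last n, fun γ => ⟨γ.2, by simp⟩⟩

theorem definable_isClass (n : ℕ) (i : Fin n) :
    (∅ : Set (WithClasses M)).Definable classLang
      {v : Fin n → WithClasses M | ∃ X : DefClass M, v i = Sum.inr X} :=
  definable_relMap (L := classLang) ∅ ClassRel.isClass fun _ => i

theorem definable_exists_obj {n : ℕ} {S : Set (Fin (n + 1) → WithClasses M)}
    (hS : (∅ : Set (WithClasses M)).Definable classLang S) :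
    (∅ : Set (WithClasses M)).Definable classLang
      {v : Fin n → WithClasses M |
        ∃ x : M, (Fin.snoc v (Sum.inl x) : Fin (n + 1) → WithClasses M) ∈ S} := by
  convert definable_exists_snoc (hS.inter (definable_isClass (n + 1) (Fin.last n)).compl) using 3
  simp

theorem definable_exists_cls {n : ℕ} {S : Set (Fin (n + 1) → WithClasses M)}
    (hS : (∅ : Set (WithClasses M)).Definable classLang S) :
    (∅ : Set (WithClasses M)).Definable classLang
      {v : Fin n → WithClasses M |
        ∃ X : DefClass M, (Fin.snoc v (Sum.inr X) : Fin (n + 1) → WithClasses M) ∈ S} := by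
  convert definable_exists_snoc (hS.inter (definable_isClass (n + 1) (Fin.last n))) using 3
  simp

theorem FODef.definable_withClasses [Ctx M Γ] {P : Γ → Prop} (h : FODef P) :
    ∀ (n : ℕ) (ι : Γ → Fin n → WithClasses M), TuplePresentation n ι →
      ∃ S, (∅ : Set (WithClasses M)).Definable classLang S ∧ ∀ γ, ι γ ∈ S ↔ P γ := by
  induction h with
  | mem' hs ht =>
    intro n ι hι
    obtain ⟨i, hi⟩ := hι.1 _ hs
    obtain ⟨j, hj⟩ := hι.1 _ ht
    refine ⟨_, definable_relMap (L := classLang) ∅ ClassRel.mem ![i, j], fun γ => ?_⟩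
    change (∃ x y : M, ι γ i = _ ∧ ι γ j = _ ∧ _) ↔ _
    simp [hi, hj]
  | eq' hs ht =>
    intro n ι hι
    obtain ⟨i, hi⟩ := hι.1 _ hs
    obtain ⟨j, hj⟩ := hι.1 _ ht
    refine ⟨_, definable_coord_eq ∅ i j, fun γ => ?_⟩
    simp [hi, hj]
  | ur' hs =>
    intro n ι hι
    obtain ⟨i, hi⟩ := hι.1 _ hs
    refine ⟨_, definable_relMap (L := classLang) ∅ ClassRel.ur fun _ => i, fun γ => ?_⟩
    change (∃ x : M, ι γ i = _ ∧ _) ↔ _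
    simp [hi]
  | cls' hs hc =>
    intro n ι hι
    obtain ⟨i, hi⟩ := hι.1 _ hs
    obtain ⟨j, hj⟩ := hι.2 _ hc
    refine ⟨_, definable_relMap (L := classLang) ∅ ClassRel.memClass ![i, j], fun γ => ?_⟩
    obtain ⟨X, hX, hXc⟩ := hj γ
    change (∃ (x : M) (X : DefClass M), ι γ i = _ ∧ ι γ j = _ ∧ _) ↔ _
    simp [hi, hX, hXc]
  | not' _ ih =>
    intro n ι hι
    obtain ⟨S, hS, h⟩ := ih n ι hι
    exact ⟨Sᶜ, hS.compl, fun γ => not_congr (h γ)⟩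
  | and' _ _ ih₁ ih₂ =>
    intro n ι hι
    obtain ⟨S, hS, h⟩ := ih₁ n ι hι
    obtain ⟨T, hT, h'⟩ := ih₂ n ι hι
    exact ⟨S ∩ T, hS.inter hT, fun γ => and_congr (h γ) (h' γ)⟩
  | ex' _ ih =>
    intro n ι hι
    obtain ⟨S, hS, h⟩ := ih (n + 1) _ hι.snoc_obj
    exact ⟨_, definable_exists_obj hS, fun γ => exists_congr fun x => h (γ, x)⟩

theorem SODef.definable_withClasses [Ctx M Γ] {P : Γ → Prop} (h : SODef P) :
    ∀ (n : ℕ) (ι : Γ → Fin n → WithClasses M), TuplePresentation n ι →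
      ∃ S, (∅ : Set (WithClasses M)).Definable classLang S ∧ ∀ γ, ι γ ∈ S ↔ P γ := by
  induction h with
  | fo hP => exact hP.definable_withClasses
  | not _ ih =>
    intro n ι hι
    obtain ⟨S, hS, h⟩ := ih n ι hι
    exact ⟨Sᶜ, hS.compl, fun γ => not_congr (h γ)⟩
  | and _ _ ih₁ ih₂ =>
    intro n ι hι
    obtain ⟨S, hS, h⟩ := ih₁ n ι hι
    obtain ⟨T, hT, h'⟩ := ih₂ n ι hι
    exact ⟨S ∩ T, hS.inter hT, fun γ => and_congr (h γ) (h' γ)⟩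
  | ex _ ih =>
    intro n ι hι
    obtain ⟨S, hS, h⟩ := ih (n + 1) _ hι.snoc_obj
    exact ⟨_, definable_exists_obj hS, fun γ => exists_congr fun x => h (γ, x)⟩
  | exClass _ ih =>
    intro n ι hι
    obtain ⟨S, hS, h⟩ := ih (n + 1) _ hι.snoc_cls
    exact ⟨_, definable_exists_cls hS, fun γ => exists_congr fun x => h (γ, x)⟩

/-- A map whose graph is second-order definable without parameters is a definable map. -/
theorem SODef.isDefinableMap {ε : DefClass M → M}
    (h : SODef fun p : (SOBase M × DefClass M) × M => ε p.1.2 = p.2) : IsDefinableMap ε := by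
  obtain ⟨S, hS, hS'⟩ := h.definable_withClasses 2 (fun p => ![Sum.inr p.1.2, Sum.inl p.2]) <| by
    constructor
    · rintro o (⟨o', ⟨o'', ho'', rfl⟩, rfl⟩ | rfl)
      · exact ho''.elim
      · exact ⟨1, fun γ => rfl⟩
    · rintro c ⟨c', (⟨c'', hc'', rfl⟩ | rfl), rfl⟩
      · exact hc''.elim
      · exact ⟨0, fun γ => ⟨γ.1.2, rfl, rfl⟩⟩
  have key := (hS.inter (definable_isClass 2 0)).inter (definable_isClass 2 1).compl
  unfold IsDefinableMap Definable₂
  convert key using 1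
  ext v
  simp only [graphOf, mem_ofPred_eq, mem_inter_iff, mem_compl_iff]
  constructor
  · rintro ⟨X, hX⟩
    rw [Prod.mk.injEq] at hX
    have hv : v = ![Sum.inr X, Sum.inl (ε X)] := by
      ext i; fin_cases i <;> simp [hX.1, hX.2]
    refine ⟨⟨?_, X, hX.1⟩, by simp [hX.2]⟩
    rw [hv]
    exact (hS' ((.nil, X), ε X)).2 rfl
  · rintro ⟨⟨hv, X, hX⟩, h1⟩
    obtain ⟨y, hy⟩ : ∃ y, v 1 = Sum.inl y := by
      cases h : v 1 with
      | inl y => exact ⟨y, rfl⟩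
      | inr Y => exact (h1 ⟨Y, h⟩).elim
    have hv' : v = ![Sum.inr X, Sum.inl y] := by
      ext i; fin_cases i <;> simp [hX, hy]
    rw [hv'] at hv
    have := (hS' ((.nil, X), y)).1 hv
    exact ⟨X, by rw [hX, hy, this]⟩

end Translation

end UrelementSetTheory

/-! ### Elementary set theory with urelements -/

namespace UrelementSetTheory

open FirstOrder

/-- `M` is a model of `ZFU_R`, as a class for instance search. -/
class ZFUR (M : Type u) [urLang.Structure M] : Prop where
  ax : IsModelZFUR M

section Basic

variable {M : Type u} [urLang.Structure M]

/-- The objects with the property `P` form a set of the model. -/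
def Small (P : M → Prop) : Prop := ∃ v : M, IsSet v ∧ ∀ z, Mem z v ↔ P z

variable [hM : ZFUR M]

theorem isSet_of_mem {x y : M} (h : Mem x y) : IsSet y :=
  fun hy => ZFUR.ax.urelements_empty y hy x h

theorem set_ext {x y : M} (hx : IsSet x) (hy : IsSet y) (h : ∀ z, Mem z x ↔ Mem z y) : x = y :=
  ZFUR.ax.extensionality x y hx hy h

variable (M) in
theorem exists_emp : ∃ e : M, IsSet e ∧ ∀ z, ¬ Mem z e := by
  obtain ⟨s, _, ⟨z, hz, _⟩, _⟩ := (ZFUR.ax (M := M)).infinity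
  exact ⟨z, hz⟩

/-- The empty set of the model. -/
noncomputable def emp : M := (exists_emp M).choose

theorem isSet_emp : IsSet (emp : M) := (exists_emp M).choose_spec.1

@[simp] theorem not_mem_emp (z : M) : ¬ Mem z emp := (exists_emp M).choose_spec.2 z

open Classical in
/-- The unique object with the property `P`; the empty set if there is no such unique object. -/
noncomputable def iota (P : M → Prop) : M := if h : ∃! x, P x then h.choose else emp

theorem iota_spec {P : M → Prop} (h : ∃! x, P x) : P (iota P) := by
  rw [iota, dif_pos h]; exact h.choose_spec.1

theorem iota_eq {P : M → Prop} {y : M} (hy : P y) (h : ∀ z, P z → z = y) : iota P = y :=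
  h _ (iota_spec ⟨y, hy, h⟩)

theorem iota_eq_iff {P : M → Prop} {y : M} : iota P = y ↔
    (P y ∧ ∀ z, P z → z = y) ∨ ((¬ ∃ x, P x ∧ ∀ z, P z → z = x) ∧ y = emp) := by
  by_cases h : ∃! x, P x
  · constructor
    · rintro rfl
      exact Or.inl ⟨iota_spec h, fun z hz => h.unique hz (iota_spec h)⟩
    · rintro (⟨h₁, h₂⟩ | ⟨h₁, _⟩)
      · exact iota_eq h₁ h₂
      · exact (h₁ h).elim
  · constructor
    · rintro rfl
      exact Or.inr ⟨h, by rw [iota, dif_neg h]⟩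
    · rintro (h' | ⟨_, rfl⟩)
      · exact (h ⟨y, h'⟩).elim
      · rw [iota, dif_neg h]

/-- The set of all objects with the property `P`; the empty set if they do not form a set. -/
noncomputable def theSet (P : M → Prop) : M := iota fun v => IsSet v ∧ ∀ z, Mem z v ↔ P z

theorem theSet_eq {P : M → Prop} {v : M} (hv : IsSet v) (h : ∀ z, Mem z v ↔ P z) : theSet P = v :=
  iota_eq ⟨hv, h⟩ fun _ hw => set_ext hw.1 hv fun z => (hw.2 z).trans (h z).symm

theorem mem_theSet {P : M → Prop} (h : Small P) {z : M} : Mem z (theSet P) ↔ P z := by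
  obtain ⟨v, hv, hv'⟩ := h
  rw [theSet_eq hv hv', hv']

theorem isSet_theSet (P : M → Prop) : IsSet (theSet P) := by
  by_cases h : Small P
  · obtain ⟨v, hv, hv'⟩ := h
    rwa [theSet_eq hv hv']
  · have : ¬ ∃! v : M, IsSet v ∧ ∀ z, Mem z v ↔ P z := fun ⟨v, hv, _⟩ => h ⟨v, hv⟩
    rw [theSet, iota, dif_neg this]
    exact isSet_emp

section Definability

variable {Γ : Type u} [Ctx M Γ]

omit hM in
theorem FODef.weakenMid {P : Γ → M → Prop} (h : FODef fun p : Γ × M => P p.1 p.2) :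
    FODef fun q : (Γ × M) × M => P q.1.1 q.2 := by
  refine h.subst (fun q : (Γ × M) × M => (q.1.1, q.2)) ?_ ?_
  · rintro o (⟨o', ho', rfl⟩ | rfl)
    · exact Or.inl ⟨_, Or.inl ⟨o', ho', rfl⟩, rfl⟩
    · exact Or.inr rfl
  · rintro c ⟨c', hc', rfl⟩
    exact ⟨_, ⟨c', hc', rfl⟩, rfl⟩

instance FOTerm.empI : FOTerm fun _ : Γ => (emp : M) := by
  refine ⟨?_⟩
  have : FODef fun p : Γ × M => IsSet p.2 ∧ ∀ z, ¬ Mem z p.2 := inferInstance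
  convert this using 3 with p
  refine ⟨?_, fun h => set_ext isSet_emp h.1 fun z => by simp [h.2 z]⟩
  rintro h
  rw [← h]
  exact ⟨isSet_emp, not_mem_emp⟩

instance FOTerm.iotaI {P : Γ → M → Prop} [h : FODef fun p : Γ × M => P p.1 p.2] :
    FOTerm fun γ => iota (P γ) := by
  refine ⟨?_⟩
  simp only [iota_eq_iff]
  have h₂ := h.weakenMid
  have h₃ := (FODef.weakenMid (P := fun (q : Γ × M) z => P q.1 z) h₂)
  have h₄ : FODef fun q : ((Γ × M) × M) × M => P q.1.1.1 q.2 := h₃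
  infer_instance

instance FOTerm.theSetI {P : Γ → M → Prop} [h : FODef fun p : Γ × M => P p.1 p.2] :
    FOTerm fun γ => theSet (P γ) := by
  have := h.weakenMid
  unfold theSet
  infer_instance

end Definability

section Sets

theorem small_pair (a b : M) : Small fun z => z = a ∨ z = b := ZFUR.ax.pairing a b

theorem small_sUnion (x : M) : Small fun z => ∃ y, Mem y x ∧ Mem z y := ZFUR.ax.union x

theorem small_power (x : M) : Small fun z => IsSet z ∧ ∀ t, Mem t z → Mem t x :=
  ZFUR.ax.powerset x

theorem small_sep {P : M → Prop} (x : M) [h : FODef fun p : FOBase M × M => P p.2] :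
    Small fun z => Mem z x ∧ P z :=
  ZFUR.ax.separation _ h.definableClass x

theorem small_of_subset {P : M → Prop} (x : M) [h : FODef fun p : FOBase M × M => P p.2]
    (hx : ∀ z, P z → Mem z x) : Small P := by
  obtain ⟨v, hv, h⟩ := small_sep x (P := P)
  exact ⟨v, hv, fun z => (h z).trans ⟨fun h => h.2, fun h => ⟨hx z h, h⟩⟩⟩

theorem small_image (F : M → M) (x : M) [h : FOTerm fun p : FOBase M × M => F p.2] :
    Small fun y => ∃ z, Mem z x ∧ y = F z := by
  obtain ⟨v, hv, hv'⟩ := ZFUR.ax.replacement (fun a b => F a = b) h.graph.definableRel x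
    fun a _ => ⟨F a, rfl, fun _ h => h.symm⟩
  exact ⟨v, hv, fun z => by simp [hv', eq_comm]⟩

/-- The set `{F z : z ∈ x}`. -/
noncomputable def img (F : M → M) (x : M) : M := theSet fun y => ∃ z, Mem z x ∧ y = F z

theorem mem_img {F : M → M} {x y : M} [FOTerm fun p : FOBase M × M => F p.2] :
    Mem y (img F x) ↔ ∃ z, Mem z x ∧ y = F z :=
  mem_theSet (small_image F x)

/-- The unordered pair `{a, b}`. -/
noncomputable def upair (a b : M) : M := theSet fun z => z = a ∨ z = b

/-- The union of the members of `x`. -/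
noncomputable def sUnion (x : M) : M := theSet fun z => ∃ y, Mem y x ∧ Mem z y

/-- The binary union. -/
noncomputable def cup (x y : M) : M := sUnion (upair x y)

/-- The powerset; its members are sets, never urelements. -/
noncomputable def power (x : M) : M := theSet fun z => IsSet z ∧ ∀ t, Mem t z → Mem t x

/-- The Kuratowski pair. -/
noncomputable def opair (a b : M) : M := upair (upair a a) (upair a b)

/-- The successor `x ∪ {x}`. -/
noncomputable def succ (x : M) : M := cup x (upair x x)

/-- The value at `x` of a set `f` of ordered pairs. -/
noncomputable def app (f x : M) : M := iota fun y => Mem (opair x y) f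

/-- The second coordinate of an ordered pair. -/
noncomputable def snd (p : M) : M := iota fun b => ∃ a, p = opair a b

@[simp] theorem mem_upair {a b z : M} : Mem z (upair a b) ↔ z = a ∨ z = b :=
  mem_theSet (small_pair a b)

@[simp] theorem mem_sUnion {x z : M} : Mem z (sUnion x) ↔ ∃ y, Mem y x ∧ Mem z y :=
  mem_theSet (small_sUnion x)

@[simp] theorem mem_cup {x y z : M} : Mem z (cup x y) ↔ Mem z x ∨ Mem z y := by simp [cup]

@[simp] theorem mem_power {x z : M} : Mem z (power x) ↔ IsSet z ∧ ∀ t, Mem t z → Mem t x :=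
  mem_theSet (small_power x)

@[simp] theorem mem_succ {x z : M} : Mem z (succ x) ↔ Mem z x ∨ z = x := by simp [succ]

theorem isSet_succ (x : M) : IsSet (succ x) := isSet_theSet _

theorem isSet_upair (a b : M) : IsSet (upair a b) := isSet_theSet _

theorem isSet_cup (a b : M) : IsSet (cup a b) := isSet_theSet _

theorem upair_inj {a b c d : M} (h : upair a b = upair c d) :
    a = c ∧ b = d ∨ a = d ∧ b = c := by
  have h' : ∀ z, z = a ∨ z = b ↔ z = c ∨ z = d := fun z => by
    rw [← mem_upair, ← mem_upair, h]
  have ha := (h' a).1 (Or.inl rfl)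
  have hb := (h' b).1 (Or.inr rfl)
  have hc := (h' c).2 (Or.inl rfl)
  have hd := (h' d).2 (Or.inr rfl)
  grind

@[simp] theorem opair_inj {a b c d : M} : opair a b = opair c d ↔ a = c ∧ b = d := by
  constructor
  · intro h
    rcases upair_inj h with ⟨h₁, h₂⟩ | ⟨h₁, h₂⟩ <;>
    rcases upair_inj h₁ with ⟨h₃, h₄⟩ | ⟨h₃, h₄⟩ <;>
    rcases upair_inj h₂ with ⟨h₅, h₆⟩ | ⟨h₅, h₆⟩ <;> grind
  · rintro ⟨rfl, rfl⟩; rfl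

theorem isOrdPair_iff {p a b : M} : IsOrdPair p a b ↔ p = opair a b := by
  constructor
  · rintro ⟨s, t, hs, ht, hp⟩
    have es : s = upair a a :=
      set_ext (isSet_of_mem ((hs a).2 rfl)) (isSet_upair _ _) fun z => by simp [hs]
    have et : t = upair a b :=
      set_ext (isSet_of_mem ((ht a).2 (Or.inl rfl))) (isSet_upair _ _) fun z => by simp [ht]
    refine set_ext (isSet_of_mem ((hp s).2 (Or.inl rfl))) (isSet_upair _ _) fun z => ?_
    rw [hp, opair, mem_upair, es, et]
  · rintro rfl
    exact ⟨upair a a, upair a b, by simp, by simp, by simp [opair]⟩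

theorem pairMem_iff {f a b : M} : PairMem f a b ↔ Mem (opair a b) f := by
  simp [PairMem, isOrdPair_iff]

theorem snd_opair (a b : M) : snd (opair a b) = b :=
  iota_eq ⟨a, rfl⟩ fun _ ⟨_, h⟩ => (opair_inj.1 h).2.symm

theorem irrefl (x : M) : ¬ Mem x x := by
  intro h
  obtain ⟨y, hy, hy'⟩ := ZFUR.ax.foundation (upair x x) ⟨x, by simp⟩
  obtain rfl : y = x := by simpa using hy
  exact hy' y h hy

end Sets

section Definability

variable {Γ : Type u} [Ctx M Γ] {s t : Γ → M} [FOTerm s] [FOTerm t]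

instance FOTerm.upairI : FOTerm fun γ => upair (s γ) (t γ) := by unfold upair; infer_instance
instance FOTerm.sUnionI : FOTerm fun γ => sUnion (s γ) := by unfold sUnion; infer_instance
instance FOTerm.cupI : FOTerm fun γ => cup (s γ) (t γ) := by unfold cup; infer_instance
instance FOTerm.powerI : FOTerm fun γ => power (s γ) := by unfold power; infer_instance
instance FOTerm.opairI : FOTerm fun γ => opair (s γ) (t γ) := by unfold opair; infer_instance
instance FOTerm.succI : FOTerm fun γ => succ (s γ) := by unfold succ; infer_instance
instance FOTerm.appI : FOTerm fun γ => app (s γ) (t γ) := by unfold app; infer_instance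
instance FOTerm.sndI : FOTerm fun γ => snd (s γ) := by unfold snd; infer_instance
instance FOTerm.imgI {F : Γ → M → M} [h : FOTerm fun p : Γ × M => F p.1 p.2] :
    FOTerm fun γ => img (F γ) (s γ) := by
  unfold img
  have : FOTerm fun q : ((Γ × M) × M) => F q.1.1 q.2 := by
    refine ⟨?_⟩
    have := h.graph.subst (fun q : ((Γ × M) × M) × M => ((q.1.1.1, q.1.2), q.2)) ?_ ?_
    · exact this
    · rintro o (⟨o', (⟨o'', ho'', rfl⟩ | rfl), rfl⟩ | rfl)
      · exact Or.inl ⟨_, Or.inl ⟨_, Or.inl ⟨o'', ho'', rfl⟩, rfl⟩, rfl⟩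
      · exact Or.inl ⟨_, Or.inr rfl, rfl⟩
      · exact Or.inr rfl
    · rintro c ⟨c', ⟨c'', hc'', rfl⟩, rfl⟩
      exact ⟨_, ⟨_, ⟨c'', hc'', rfl⟩, rfl⟩, rfl⟩
  have : FOTerm fun q : ((Γ × M) × M) × M => F q.1.1.1 q.2 := by
    refine ⟨?_⟩
    have := h.graph.subst (fun q : (((Γ × M) × M) × M) × M => ((q.1.1.1.1, q.1.2), q.2)) ?_ ?_
    · exact this
    · rintro o (⟨o', (⟨o'', ho'', rfl⟩ | rfl), rfl⟩ | rfl)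
      · exact Or.inl ⟨_, Or.inl ⟨_, Or.inl ⟨_, Or.inl ⟨o'', ho'', rfl⟩, rfl⟩, rfl⟩, rfl⟩
      · exact Or.inl ⟨_, Or.inr rfl, rfl⟩
      · exact Or.inr rfl
    · rintro c ⟨c', ⟨c'', hc'', rfl⟩, rfl⟩
      exact ⟨_, ⟨_, ⟨_, ⟨c'', hc'', rfl⟩, rfl⟩, rfl⟩, rfl⟩
  infer_instance

omit hM in
/-- Definition by cases. -/
theorem FOTerm.ite {P : Γ → Prop} [∀ γ, Decidable (P γ)] [FODef P] :
    FOTerm fun γ => if P γ then s γ else t γ := by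
  refine ⟨?_⟩
  have : FODef fun p : Γ × M => (P p.1 ∧ s p.1 = p.2) ∨ (¬ P p.1 ∧ t p.1 = p.2) := by
    have := FODef.weaken (P := P) inferInstance
    infer_instance
  convert this using 3 with p
  by_cases h : P p.1 <;> simp [h]

end Definability

end Basic

end UrelementSetTheory

/-! ### Recursion along membership, the set `ω`, and foundation for definable classes -/

namespace UrelementSetTheory

open FirstOrder

section Recursion

variable {M : Type u} [urLang.Structure M] [hM : ZFUR M]

/-- `t` contains the members of its members. -/
def Trans (t : M) : Prop := ∀ y, Mem y t → ∀ z, Mem z y → Mem z t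

theorem exists_minimal {P : M → Prop} [FODef fun p : FOBase M × M => P p.2] (t : M)
    (h : ∃ x, Mem x t ∧ P x) : ∃ x, Mem x t ∧ P x ∧ ∀ y, Mem y x → Mem y t → ¬ P y := by
  obtain ⟨v, _, hv⟩ := small_sep t (P := P)
  obtain ⟨x, hx⟩ := h
  obtain ⟨y, hy, hy'⟩ := ZFUR.ax.foundation v ⟨x, (hv x).2 hx⟩
  exact ⟨y, ((hv y).1 hy).1, ((hv y).1 hy).2, fun z hz hzt hP => hy' z hz ((hv z).2 ⟨hzt, hP⟩)⟩

theorem img_congr {F G : M → M} {x : M} (h : ∀ y, Mem y x → F y = G y) : img F x = img G x := by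
  unfold img
  congr 1
  ext y
  exact exists_congr fun z => and_congr_right fun hz => by rw [h z hz]

theorem app_eq {f x y : M} (hy : ∀ z, Mem (opair x z) f ↔ z = y) : app f x = y :=
  iota_eq ((hy y).2 rfl) fun z hz => (hy z).1 hz

/-- The restriction of a definable function to a set is a set. -/
theorem exists_app (F : M → M) [FOTerm fun p : FOBase M × M => F p.2] (d : M) :
    ∃ f, ∀ x, Mem x d → app f x = F x := by
  refine ⟨img (fun x => opair x (F x)) d, fun x hx => app_eq fun z => ?_⟩
  rw [mem_img]
  constructor
  · rintro ⟨y, _, h⟩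
    obtain ⟨rfl, rfl⟩ := opair_inj.1 h
    rfl
  · rintro rfl
    exact ⟨x, hx, rfl⟩

/-- `f` is a partial solution, on the transitive set `d`, of the recursion with step `Ψ`. -/
def Attempt (Ψ : M → M → M) (f d : M) : Prop :=
  Trans d ∧ ∀ x, Mem x d → app f x = Ψ x (img (fun y => app f y) x)

/-- The function `F` with `F x = Ψ x {F y : y ∈ x}`. -/
noncomputable def recF (Ψ : M → M → M) (x : M) : M :=
  iota fun r => ∃ f d, Attempt Ψ f d ∧ Mem x d ∧ app f x = r

section Definability

variable {Γ : Type u} [Ctx M Γ] {s t : Γ → M}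

omit hM in
instance FODef.transI [FOTerm s] : FODef fun γ => Trans (s γ) := by unfold Trans; infer_instance

theorem FOTerm.recF_of_forall {Ψ : M → M → M}
    (h : ∀ {Γ : Type u} [Ctx M Γ] (s t : Γ → M) [FOTerm s] [FOTerm t],
      FOTerm fun γ => Ψ (s γ) (t γ)) [FOTerm t] : FOTerm fun γ => recF Ψ (t γ) := by
  unfold recF Attempt
  infer_instance

theorem FOTerm.recF {Ψ : M → M → M} (h : FOTerm fun p : (FOBase M × M) × M => Ψ p.1.2 p.2)
    [FOCtx M Γ] [FOTerm t] : FOTerm fun γ => recF Ψ (t γ) := by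
  have : ∀ {Γ : Type u} [Ctx M Γ] [FOCtx M Γ] (s t : Γ → M) [FOTerm s] [FOTerm t],
      FOTerm fun γ => Ψ (s γ) (t γ) := fun s t => FOTerm.fn₂ h s t
  unfold UrelementSetTheory.recF Attempt
  infer_instance

end Definability

variable {Ψ : M → M → M}

theorem Attempt.eq [FOTerm fun p : (FOBase M × M) × M => Ψ p.1.2 p.2] {f d f' d' : M}
    (h : Attempt Ψ f d) (h' : Attempt Ψ f' d') {x : M} (hx : Mem x d) (hx' : Mem x d') :
    app f x = app f' x := by
  by_contra hne
  obtain ⟨y, hy, ⟨hy', hne⟩, hmin⟩ :=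
    exists_minimal (P := fun x => Mem x d' ∧ app f x ≠ app f' x) d ⟨x, hx, hx', hne⟩
  refine hne ?_
  rw [h.2 y hy, h'.2 y hy']
  congr 1
  refine img_congr fun z hz => ?_
  by_contra hne'
  exact hmin z hz (h.1 y hy z hz) ⟨h'.1 y hy' z hz, hne'⟩

theorem Attempt.recF_eq [FOTerm fun p : (FOBase M × M) × M => Ψ p.1.2 p.2] {f d : M}
    (h : Attempt Ψ f d) {x : M} (hx : Mem x d) : recF Ψ x = app f x := by
  refine iota_eq ⟨f, d, h, hx, rfl⟩ ?_
  rintro _ ⟨f', d', h', hx', rfl⟩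
  exact h'.eq h hx' hx

theorem exists_attempt [hΨ : FOTerm fun p : (FOBase M × M) × M => Ψ p.1.2 p.2] {t x : M}
    (ht : Trans t) (hx : Mem x t) : ∃ f d, Attempt Ψ f d ∧ Mem x d := by
  have inst : ∀ {Γ : Type u} [Ctx M Γ] [FOCtx M Γ] (s t : Γ → M) [FOTerm s] [FOTerm t],
      FOTerm fun γ => Ψ (s γ) (t γ) := fun s t => FOTerm.fn₂ hΨ s t
  have instR : ∀ {Γ : Type u} [Ctx M Γ] [FOCtx M Γ] (t : Γ → M) [FOTerm t],
      FOTerm fun γ => recF Ψ (t γ) := fun t => FOTerm.recF hΨ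
  have instA : ∀ {Γ : Type u} [Ctx M Γ] [FOCtx M Γ] (s t : Γ → M) [FOTerm s] [FOTerm t],
      FODef fun γ => Attempt Ψ (s γ) (t γ) := fun s t => by unfold Attempt; infer_instance
  by_contra hcon
  obtain ⟨x, hx, hcon, hmin⟩ :=
    exists_minimal (P := fun x => ¬ ∃ f d, Attempt Ψ f d ∧ Mem x d) t ⟨x, hx, hcon⟩
  -- the solvable part `c` of `t` is itself the domain of an attempt, which extends to `x`
  obtain ⟨c, hc, hc'⟩ := small_sep t (P := fun x => ∃ f d, Attempt Ψ f d ∧ Mem x d)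
  have hcx : ¬ Mem x c := fun h => hcon ((hc' x).1 h).2
  have hxc : ∀ y, Mem y x → Mem y c := fun y hy =>
    (hc' y).2 ⟨ht x hx y hy, not_not.1 (hmin y hy (ht x hx y hy))⟩
  have hct : Trans c := by
    intro y hy z hz
    obtain ⟨hyt, f, d, h, hyd⟩ := (hc' y).1 hy
    exact (hc' z).2 ⟨ht y hyt z hz, f, d, h, h.1 y hyd z hz⟩
  classical
  have : FOTerm fun p : FOBase M × M =>
      if p.2 = x then Ψ x (img (fun y => recF Ψ y) x) else recF Ψ p.2 := FOTerm.ite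
  obtain ⟨f, hf⟩ := exists_app
    (fun z => if z = x then Ψ x (img (fun y => recF Ψ y) x) else recF Ψ z) (cup c (upair x x))
  have hfc : ∀ y, Mem y c → app f y = recF Ψ y := fun y hy => by
    have hyx : y ≠ x := by rintro rfl; exact hcx hy
    rw [hf y (by simp [hy]), if_neg hyx]
  refine hcon ⟨f, cup c (upair x x), ⟨?_, ?_⟩, by simp⟩
  · intro y hy z hz
    rw [mem_cup]
    refine Or.inl ?_
    rcases mem_cup.1 hy with hy | hy
    · exact hct y hy z hz
    · obtain rfl : y = x := by simpa using hy
      exact hxc z hz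
  · intro y hy
    rcases mem_cup.1 hy with hy | hy
    · obtain ⟨_, g, d, h, hyd⟩ := (hc' y).1 hy
      rw [hfc y hy, h.recF_eq hyd, h.2 y hyd]
      congr 1
      refine img_congr fun z hz => ?_
      rw [hfc z (hct y hy z hz), h.recF_eq (h.1 y hyd z hz)]
    · obtain rfl : y = x := by simpa using hy
      rw [hf y (by simp), if_pos rfl]
      congr 1
      exact img_congr fun z hz => (hfc z (hxc z hz)).symm

/-- The recursion equation inside a transitive set. The existence of transitive closures is itself
proved by such a recursion, along `ω`. -/
theorem recF_eq_of_trans [FOTerm fun p : (FOBase M × M) × M => Ψ p.1.2 p.2] {t x : M}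
    (ht : Trans t) (hx : Mem x t) : recF Ψ x = Ψ x (img (fun y => recF Ψ y) x) := by
  obtain ⟨f, d, h, hxd⟩ := exists_attempt ht hx (Ψ := Ψ)
  rw [h.recF_eq hxd, h.2 x hxd]
  congr 1
  exact img_congr fun z hz => (h.recF_eq (h.1 x hxd z hz)).symm

end Recursion

section Omega

variable {M : Type u} [urLang.Structure M] [hM : ZFUR M]

theorem isEmptySet_iff {z : M} : IsEmptySet z ↔ z = emp := by
  constructor
  · exact fun h => set_ext h.1 isSet_emp fun t => by simp [h.2 t]
  · rintro rfl
    exact ⟨isSet_emp, not_mem_emp⟩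

theorem isSucc_iff {x y : M} : IsSucc x y ↔ y = succ x := by
  constructor
  · exact fun h => set_ext h.1 (isSet_succ x) fun t => by simp [h.2 t]
  · rintro rfl
    exact ⟨isSet_succ x, fun t => mem_succ⟩

theorem isInductive_iff {s : M} :
    IsInductive s ↔ IsSet s ∧ Mem emp s ∧ ∀ x, Mem x s → Mem (succ x) s := by
  simp [IsInductive, isEmptySet_iff, isSucc_iff]

/-- The least inductive set of the model. -/
noncomputable def omega : M := theSet fun n => ∀ s, IsInductive s → Mem n s

instance FODef.isInductiveI {Γ : Type u} [Ctx M Γ] {s : Γ → M} [FOTerm s] :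
    FODef fun γ => IsInductive (s γ) := by
  simp only [isInductive_iff]; infer_instance

instance FOTerm.omegaI {Γ : Type u} [Ctx M Γ] : FOTerm fun _ : Γ => (omega : M) := by
  unfold omega; infer_instance

theorem mem_omega {n : M} : Mem n omega ↔ ∀ s, IsInductive s → Mem n s := by
  obtain ⟨s, hs⟩ := (ZFUR.ax (M := M)).infinity
  exact mem_theSet (small_of_subset s fun z hz => hz s hs)

theorem emp_mem_omega : Mem (emp : M) omega :=
  mem_omega.2 fun _ hs => (isInductive_iff.1 hs).2.1

theorem succ_mem_omega {n : M} (h : Mem n omega) : Mem (succ n) omega :=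
  mem_omega.2 fun s hs => (isInductive_iff.1 hs).2.2 n (mem_omega.1 h s hs)

theorem omega_induction {P : M → Prop} [FODef fun p : FOBase M × M => P p.2] (h0 : P emp)
    (hs : ∀ n, Mem n omega → P n → P (succ n)) {n : M} (hn : Mem n omega) : P n := by
  obtain ⟨v, hv, hv'⟩ := small_sep omega (P := P)
  refine ((hv' n).1 (mem_omega.1 hn v (isInductive_iff.2 ⟨hv, ?_, ?_⟩))).2
  · exact (hv' _).2 ⟨emp_mem_omega, h0⟩
  · exact fun x hx => (hv' _).2 ⟨succ_mem_omega ((hv' x).1 hx).1, hs x ((hv' x).1 hx).1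
      ((hv' x).1 hx).2⟩

theorem trans_omega : Trans (omega : M) := fun n hn => by
  refine omega_induction (P := fun n => ∀ z, Mem z n → Mem z omega) (by simp) ?_ hn
  intro n hn ih z hz
  rcases mem_succ.1 hz with hz | rfl
  · exact ih z hz
  · exact hn

theorem trans_of_mem_omega {n : M} (hn : Mem n omega) : Trans n := by
  refine omega_induction (P := fun n => Trans n) (fun y hy => by simp at hy) ?_ hn
  intro n _ ih y hy z hz
  rcases mem_succ.1 hy with hy | rfl
  · exact mem_succ.2 (Or.inl (ih y hy z hz))
  · exact mem_succ.2 (Or.inl hz)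

theorem succ_mem_succ {n k : M} (hn : Mem n omega) (hk : Mem k n) : Mem (succ k) (succ n) := by
  refine omega_induction (P := fun n => ∀ k, Mem k n → Mem (succ k) (succ n)) (by simp) ?_ hn k hk
  intro n _ ih k hk
  rcases mem_succ.1 hk with hk | rfl
  · exact mem_succ.2 (Or.inl (ih k hk))
  · simp

theorem emp_mem_succ {n : M} (hn : Mem n omega) : Mem emp (succ n) := by
  refine omega_induction (P := fun n => Mem emp (succ n)) (by simp) ?_ hn
  exact fun n _ ih => mem_succ.2 (Or.inl ih)

theorem omega_trichotomy {m n : M} (hm : Mem m omega) (hn : Mem n omega) :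
    Mem m n ∨ m = n ∨ Mem n m := by
  refine omega_induction
    (P := fun n => ∀ m, Mem m omega → Mem m n ∨ m = n ∨ Mem n m) ?_ ?_ hn m hm
  · intro m hm
    refine omega_induction (P := fun m => Mem m emp ∨ m = emp ∨ Mem emp m) (by simp) ?_ hm
    exact fun n hn _ => Or.inr (Or.inr (emp_mem_succ hn))
  · intro n _ ih m hm
    rcases ih m hm with h | rfl | h
    · exact Or.inl (mem_succ.2 (Or.inl h))
    · exact Or.inl (mem_succ.2 (Or.inr rfl))
    · rcases mem_succ.1 (succ_mem_succ hm h) with h | h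
      · exact Or.inr (Or.inr h)
      · exact Or.inr (Or.inl h.symm)

end Omega

section Foundation

variable {M : Type u} [urLang.Structure M] [hM : ZFUR M]

/-- Transitive closures: iterate the union along `ω`. -/
theorem exists_trans (x : M) : ∃ t, Trans t ∧ Mem x t := by
  set Ψ : M → M → M := fun _ Y => cup x (sUnion (sUnion Y)) with hΨ
  have inst : FOTerm fun p : (FOBase M × M) × M => Ψ p.1.2 p.2 := by
    simp only [hΨ]; infer_instance
  have instR : ∀ {Γ : Type u} [Ctx M Γ] [FOCtx M Γ] (t : Γ → M) [FOTerm t],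
      FOTerm fun γ => recF Ψ (t γ) := fun t => FOTerm.recF inst
  have key : ∀ n, Mem n omega → recF Ψ n = cup x (sUnion (sUnion (img (fun y => recF Ψ y) n))) :=
    fun n hn => recF_eq_of_trans trans_omega hn
  refine ⟨cup (sUnion (img (fun y => recF Ψ y) omega)) (upair x x), ?_, by simp⟩
  intro y hy z hz
  rw [mem_cup]
  left
  rcases mem_cup.1 hy with hy | hy
  · obtain ⟨v, hv, hyv⟩ := mem_sUnion.1 hy
    obtain ⟨n, hn, rfl⟩ := mem_img.1 hv
    refine mem_sUnion.2 ⟨_, mem_img.2 ⟨succ n, succ_mem_omega hn, rfl⟩, ?_⟩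
    rw [key _ (succ_mem_omega hn), mem_cup]
    exact Or.inr (mem_sUnion.2 ⟨y, mem_sUnion.2 ⟨_, mem_img.2 ⟨n, by simp, rfl⟩, hyv⟩, hz⟩)
  · obtain rfl : y = x := by simpa using hy
    refine mem_sUnion.2 ⟨_, mem_img.2 ⟨emp, emp_mem_omega, rfl⟩, ?_⟩
    rw [key _ emp_mem_omega, mem_cup]
    exact Or.inl hz

/-- Foundation for definable classes, in the form of induction along membership. -/
theorem eps_induction {P : M → Prop} [FODef fun p : FOBase M × M => P p.2]
    (h : ∀ x, (∀ y, Mem y x → P y) → P x) (x : M) : P x := by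
  by_contra hx
  obtain ⟨t, ht, hxt⟩ := exists_trans x
  obtain ⟨y, hy, hPy, hmin⟩ := exists_minimal (P := fun x => ¬ P x) t ⟨x, hxt, hx⟩
  exact hPy (h y fun z hz => not_not.1 (hmin z hz (ht y hy z hz)))

theorem recF_eq {Ψ : M → M → M} [FOTerm fun p : (FOBase M × M) × M => Ψ p.1.2 p.2] (x : M) :
    recF Ψ x = Ψ x (img (fun y => recF Ψ y) x) :=
  let ⟨_, ht, hx⟩ := exists_trans x
  recF_eq_of_trans ht hx

end Foundation

section Numerals

variable {M : Type u} [urLang.Structure M] [hM : ZFUR M]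

/-- The standard natural numbers of the model. -/
noncomputable def num : ℕ → M
  | 0 => emp
  | n + 1 => succ (num n)

instance FOTerm.numI {Γ : Type u} [Ctx M Γ] (n : ℕ) : FOTerm fun _ : Γ => (num n : M) := by
  induction n with
  | zero => exact FOTerm.empI
  | succ n ih => exact FOTerm.succI (s := fun _ => num n)

theorem num_mem_omega (n : ℕ) : Mem (num n : M) omega := by
  induction n with
  | zero => exact emp_mem_omega
  | succ n ih => exact succ_mem_omega ih

theorem mem_num {n : ℕ} {z : M} : Mem z (num n) ↔ ∃ k < n, z = num k := by
  induction n with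
  | zero => simp [num]
  | succ n ih =>
    rw [num, mem_succ, ih]
    constructor
    · rintro (⟨k, hk, rfl⟩ | rfl)
      · exact ⟨k, by omega, rfl⟩
      · exact ⟨n, by omega, rfl⟩
    · rintro ⟨k, hk, rfl⟩
      rcases Nat.lt_succ_iff_lt_or_eq.1 hk with hk | rfl
      · exact Or.inl ⟨k, hk, rfl⟩
      · exact Or.inr rfl

@[simp] theorem num_inj {m n : ℕ} : (num m : M) = num n ↔ m = n := by
  refine ⟨fun h => ?_, fun h => by rw [h]⟩
  rcases lt_trichotomy m n with hmn | rfl | hmn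
  · exact (irrefl (num n : M) (mem_num.2 ⟨m, hmn, h.symm⟩)).elim
  · rfl
  · exact (irrefl (num m : M) (mem_num.2 ⟨n, hmn, h⟩)).elim

@[simp] theorem num_mem_num {m n : ℕ} : Mem (num m : M) (num n) ↔ m < n := by
  rw [mem_num]
  constructor
  · rintro ⟨k, hk, h⟩
    rwa [num_inj.1 h]
  · exact fun h => ⟨m, h, rfl⟩

end Numerals

end UrelementSetTheory

/-! ### Scott's trick and satisfaction classes -/

namespace UrelementSetTheory

open FirstOrder

section Levels

variable {M : Type u} [urLang.Structure M]

/-- Every member of `x` is a member of `y`. -/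
def Sub (x y : M) : Prop := ∀ t, Mem t x → Mem t y

instance FODef.subI {Γ : Type u} [Ctx M Γ] {s t : Γ → M} [FOTerm s] [FOTerm t] :
    FODef fun γ => Sub (s γ) (t γ) := by unfold Sub; infer_instance

variable [hM : ZFUR M]

/-- The step of the recursion for the cumulative hierarchy over the urelements: all urelements
together with all subsets of members of `Y`. -/
noncomputable def levelStep (_x Y : M) : M :=
  theSet fun z => IsUr z ∨ ∃ v, Mem v Y ∧ IsSet z ∧ Sub z v

/-- The level of the cumulative hierarchy over the urelements whose index is the rank of `x`. -/
noncomputable def level (x : M) : M := recF levelStep x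

theorem FOTerm.levelStep {Γ : Type u} [Ctx M Γ] (s t : Γ → M) [FOTerm s] [FOTerm t] :
    FOTerm fun γ => levelStep (s γ) (t γ) := by
  unfold UrelementSetTheory.levelStep; infer_instance

instance FOTerm.levelI {Γ : Type u} [Ctx M Γ] {t : Γ → M} [FOTerm t] :
    FOTerm fun γ => level (t γ) :=
  FOTerm.recF_of_forall FOTerm.levelStep

theorem mem_level (hA : UrelementsFormSet M) {x z : M} :
    Mem z (level x) ↔ IsUr z ∨ ∃ y, Mem y x ∧ IsSet z ∧ Sub z (level y) := by
  obtain ⟨A, _, hA⟩ := hA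
  have : FOTerm fun p : (FOBase M × M) × M => levelStep p.1.2 p.2 := FOTerm.levelStep _ _
  rw [level, recF_eq, levelStep, mem_theSet]
  · have : FOTerm fun p : FOBase M × M => recF levelStep p.2 :=
      inferInstanceAs (FOTerm fun p : FOBase M × M => level p.2)
    simp only [mem_img]
    refine or_congr_right ⟨?_, ?_⟩
    · rintro ⟨_, ⟨y, hy, rfl⟩, h⟩
      exact ⟨y, hy, h⟩
    · rintro ⟨y, hy, h⟩
      exact ⟨_, ⟨y, hy, rfl⟩, h⟩
  · set Y := img (fun y => recF levelStep y) x
    refine small_of_subset (cup A (sUnion (img (fun v => power v) Y))) ?_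
    rintro z (hz | ⟨v, hv, hz, hzv⟩)
    · exact mem_cup.2 (Or.inl ((hA z).2 hz))
    · exact mem_cup.2 (Or.inr (mem_sUnion.2 ⟨_, mem_img.2 ⟨v, hv, rfl⟩, mem_power.2 ⟨hz, hzv⟩⟩))

theorem isSet_level (x : M) : IsSet (level x) := by
  have : FOTerm fun p : (FOBase M × M) × M => levelStep p.1.2 p.2 := FOTerm.levelStep _ _
  rw [level, recF_eq, levelStep]
  exact isSet_theSet _

variable (hA : UrelementsFormSet M)
include hA

theorem level_mono {x y : M} (h : Mem y x) : Sub (level y) (level x) := by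
  refine eps_induction (P := fun x => ∀ y, Mem y x → Sub (level y) (level x)) ?_ x y h
  intro x ih y hy t ht
  rcases (mem_level hA).1 ht with ht | ⟨w, hw, ht, htw⟩
  · exact (mem_level hA).2 (Or.inl ht)
  · exact (mem_level hA).2 (Or.inr ⟨y, hy, ht, fun z hz => ih y hy w hw z (htw z hz)⟩)

theorem level_mem_level {x y : M} (h : Mem y x) : Mem (level y) (level x) :=
  (mem_level hA).2 (Or.inr ⟨y, h, isSet_level y, fun _ h => h⟩)

theorem mem_level_of_sub {x y z : M} (h : Mem (level y) (level x)) (hz : IsSet z)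
    (hzy : Sub z (level y)) : Mem z (level x) := by
  rcases (mem_level hA).1 h with h | ⟨w, hw, _, h⟩
  · exact (isSet_level y h).elim
  · exact (mem_level hA).2 (Or.inr ⟨w, hw, hz, fun t ht => h t (hzy t ht)⟩)

theorem sub_level (x : M) : Sub x (level x) := by
  refine eps_induction (P := fun x => Sub x (level x)) ?_ x
  intro x ih y hy
  by_cases h : IsUr y
  · exact (mem_level hA).2 (Or.inl h)
  · exact (mem_level hA).2 (Or.inr ⟨y, hy, h, ih y hy⟩)

theorem exists_of_not_sub_level {x : M} {w : M} (h : ¬ Sub (level x) (level w)) :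
    ∃ z y, Mem y x ∧ IsSet z ∧ Sub z (level y) ∧ ¬ Mem z (level w) := by
  simp only [Sub, not_forall] at h
  obtain ⟨z, hz, hzw⟩ := h
  rcases (mem_level hA).1 hz with hz | ⟨y, hy, hz, hzy⟩
  · exact (hzw ((mem_level hA).2 (Or.inl hz))).elim
  · exact ⟨z, y, hy, hz, hzy, hzw⟩

theorem level_comparable (x y : M) : Sub (level x) (level y) ∨ Mem (level y) (level x) := by
  refine eps_induction
    (P := fun x => ∀ y, Sub (level x) (level y) ∨ Mem (level y) (level x)) ?_ x y
  intro x ih y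
  by_contra hcon
  obtain ⟨h₁, h₂⟩ := not_or.1 hcon
  obtain ⟨z, x', hx', hz, hzx', hzy⟩ := exists_of_not_sub_level hA h₁
  rcases ih x' hx' y with h | h
  · have hyx' : ¬ Sub (level y) (level x') := fun h' => by
      have : level y = level x' :=
        set_ext (isSet_level y) (isSet_level x') fun t => ⟨h' t, h t⟩
      exact h₂ (this ▸ level_mem_level hA hx')
    obtain ⟨z', y', hy', hz', hzy', hzx''⟩ := exists_of_not_sub_level hA hyx'
    rcases ih x' hx' y' with h' | h'
    · exact hzy ((mem_level hA).2 (Or.inr ⟨y', hy', hz, fun t ht => h' t (hzx' t ht)⟩))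
    · exact hzx'' (mem_level_of_sub hA h' hz' hzy')
  · exact h₂ (level_mono hA hx' _ h)

/-- Every nonempty definable class has members of least level. -/
theorem exists_least_level {P : M → Prop} [FODef fun p : FOBase M × M => P p.2] {p : M}
    (hp : P p) : ∃ p, P p ∧ ∀ q, P q → Sub (level p) (level q) := by
  have inst : ∀ {Γ : Type u} [Ctx M Γ] [FOCtx M Γ] (t : Γ → M) [FOTerm t],
      FODef fun γ => P (t γ) := fun t => FODef.pred inferInstance t
  refine eps_induction (P := fun r => ∀ p, P p → level p = r →
    ∃ p, P p ∧ ∀ q, P q → Sub (level p) (level q)) ?_ (level p) p hp rfl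
  rintro _ ih p hp rfl
  by_cases h : ∀ q, P q → Sub (level p) (level q)
  · exact ⟨p, hp, h⟩
  · push Not at h
    obtain ⟨q, hq, hpq⟩ := h
    exact ih _ ((level_comparable hA p q).resolve_left hpq) q hq rfl

/-- Scott's trick: the members of least level of a definable class form a set. -/
theorem small_least_level {P : M → Prop} [FODef fun p : FOBase M × M => P p.2] :
    Small fun p => P p ∧ ∀ q, P q → Sub (level p) (level q) := by
  have inst : ∀ {Γ : Type u} [Ctx M Γ] [FOCtx M Γ] (t : Γ → M) [FOTerm t],
      FODef fun γ => P (t γ) := fun t => FODef.pred inferInstance t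
  by_cases h : ∃ p, P p
  · obtain ⟨p, hp⟩ := h
    refine small_of_subset (cup (level p) (power (level p))) ?_
    rintro q ⟨_, hq⟩
    rw [mem_cup, mem_power]
    by_cases hqu : IsUr q
    · exact Or.inl ((mem_level hA).2 (Or.inl hqu))
    · exact Or.inr ⟨hqu, fun t ht => hq p hp t (sub_level hA q t ht)⟩
  · exact small_of_subset emp fun q hq => (h ⟨q, hq.1⟩).elim

end Levels

section Satisfaction

variable {M : Type u} [urLang.Structure M] [hM : ZFUR M]

/-- `z` is the value of the term code `b` under the assignment `s`: codes are `⟨0, z⟩` for the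
parameter `z` and `⟨1, i⟩` for the variable with index `i`; assignments are sets of pairs. -/
def Val (b s z : M) : Prop :=
  b = opair (num 0) z ∨ ∃ i, b = opair (num 1) i ∧ Mem (opair i z) s

/-- The assignment `s'` arises from `s` by giving the variable with index `c` the value `y`. -/
def Upd (s c y s' : M) : Prop :=
  ∀ i z, Mem (opair i z) s' ↔ (i = c ∧ z = y) ∨ (i ≠ c ∧ Mem (opair i z) s)

/-- The clause for universal quantification over the variable with index `c`. -/
def UpdAll (X : Set M) (m a s c : M) : Prop :=
  ∀ y s', Upd s c y s' → opair m (opair a s') ∈ X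

/-- The clause for the atomic formula stating that the value of `a` is a member of that of `b`. -/
def SatMem (s a b : M) : Prop := ∃ x y, Val a s x ∧ Val b s y ∧ Mem x y

/-- The clause for equations between terms. -/
def SatEq (s a b : M) : Prop := ∃ x y, Val a s x ∧ Val b s y ∧ x = y

/-- The clause for the urelement predicate. -/
def SatUr (s a : M) : Prop := ∃ x, Val a s x ∧ IsUr x

/-- The clause for implications; `a` and `b` are pairs of a level below `k` and a code. -/
def SatImp (X : Set M) (k s a b : M) : Prop :=
  ∃ m a' n b', a = opair m a' ∧ b = opair n b' ∧ Mem m k ∧ Mem n k ∧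
    (opair m (opair a' s) ∈ X → opair n (opair b' s) ∈ X)

/-- The clause for universal formulas; `a` is a pair of a level below `k` and a code. -/
def SatAll (X : Set M) (k s a c : M) : Prop :=
  ∃ m a', a = opair m a' ∧ Mem m k ∧ UpdAll X m a' s c

/-- One step in the construction of a satisfaction class. The class `X` consists of triples
`⟨m, ⟨p, s⟩⟩`, read as "the formula code `p` of level `m` is satisfied by the assignment `s`".
`Jump X k p s` says that the code `p` of level `k` is satisfied by `s`, if `X` is correct for the
levels `m ∈ k`. Codes are `⟨tag, ⟨a, b⟩⟩`; the immediate subformulas are coded together with their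
levels. -/
def Jump (X : Set M) (k p s : M) : Prop :=
  ∃ a b, (p = opair (num 0) (opair a b) ∧ SatMem s a b) ∨
    (p = opair (num 1) (opair a b) ∧ SatEq s a b) ∨
    (p = opair (num 2) (opair a b) ∧ SatUr s a) ∨
    (p = opair (num 3) (opair a b) ∧ SatImp X k s a b) ∨
    (p = opair (num 4) (opair a b) ∧ SatAll X k s a b)

/-- `X` is a satisfaction class for the codes whose level is a member of `n`. -/
def IsSatBelow (X : Set M) (n : M) : Prop :=
  ∀ k, Mem k n → ∀ p s, opair k (opair p s) ∈ X ↔ Jump X k p s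

/-- The assignment that gives the variable with index `0` the value `x`. -/
noncomputable def single (x : M) : M := upair (opair emp x) (opair emp x)

/-- `Y` is the class defined by the code `p` of level `n`, according to the satisfaction
class `X`. -/
def Defines (X : Set M) (n p : M) (Y : Set M) : Prop :=
  ∀ x, x ∈ Y ↔ opair n (opair p (single x)) ∈ X

/-- Among the codes of level `n` that define `Y`, the code `p` has least level in the cumulative
hierarchy. -/
def LeastDefines (X : Set M) (n : M) (Y : Set M) (p : M) : Prop :=
  Defines X n p Y ∧ ∀ q, Defines X n q Y → Sub (level p) (level q)

section Definability

variable {Γ : Type u} [Ctx M Γ] {a b c d e : Γ → M} [FOTerm a] [FOTerm b] [FOTerm c] [FOTerm d]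
  [FOTerm e] {X Y : Γ → Set M} [FOClass X] [FOClass Y]

instance FODef.valI : FODef fun γ => Val (a γ) (b γ) (c γ) := by unfold Val; infer_instance
instance FODef.updI : FODef fun γ => Upd (a γ) (b γ) (c γ) (d γ) := by unfold Upd; infer_instance
instance FODef.updAllI : FODef fun γ => UpdAll (X γ) (a γ) (b γ) (c γ) (d γ) := by
  unfold UpdAll; infer_instance
instance FODef.satMemI : FODef fun γ => SatMem (a γ) (b γ) (c γ) := by
  unfold SatMem; infer_instance
instance FODef.satEqI : FODef fun γ => SatEq (a γ) (b γ) (c γ) := by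
  unfold SatEq; infer_instance
instance FODef.satUrI : FODef fun γ => SatUr (a γ) (b γ) := by unfold SatUr; infer_instance
instance FODef.satImpI : FODef fun γ => SatImp (X γ) (a γ) (b γ) (c γ) (d γ) := by
  unfold SatImp; infer_instance
instance FODef.satAllI : FODef fun γ => SatAll (X γ) (a γ) (b γ) (c γ) (d γ) := by
  unfold SatAll; infer_instance
instance FODef.jumpI : FODef fun γ => Jump (X γ) (a γ) (b γ) (c γ) := by
  unfold Jump; infer_instance
instance FODef.isSatBelowI : FODef fun γ => IsSatBelow (X γ) (a γ) := by
  unfold IsSatBelow; infer_instance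
instance FOTerm.singleI : FOTerm fun γ => single (a γ) := by unfold single; infer_instance
instance FODef.definesI : FODef fun γ => Defines (X γ) (a γ) (b γ) (Y γ) := by
  unfold Defines; infer_instance
instance FODef.leastDefinesI : FODef fun γ => LeastDefines (X γ) (a γ) (Y γ) (b γ) := by
  unfold LeastDefines; infer_instance

end Definability

theorem jump_congr {X Y : Set M} {k p s : M}
    (h : ∀ m, Mem m k → ∀ p s, opair m (opair p s) ∈ X ↔ opair m (opair p s) ∈ Y) :
    Jump X k p s ↔ Jump Y k p s := by
  have himp : ∀ a b, SatImp X k s a b ↔ SatImp Y k s a b := fun a b => by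
    unfold SatImp
    refine exists_congr fun m => exists_congr fun a' => exists_congr fun n => exists_congr fun b' =>
      and_congr_right fun _ => and_congr_right fun _ => and_congr_right fun hm =>
      and_congr_right fun hn => ?_
    rw [h m hm, h n hn]
  have hall : ∀ a b, SatAll X k s a b ↔ SatAll Y k s a b := fun a b => by
    unfold SatAll UpdAll
    refine exists_congr fun m => exists_congr fun a' =>
      and_congr_right fun _ => and_congr_right fun hm => ?_
    simp only [h m hm]
  simp only [Jump, himp, hall]

/-- Satisfaction classes are unique. -/
theorem IsSatBelow.unique {X Y : DefClass M} {n : M} (hn : Trans n) (hX : IsSatBelow X.1 n)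
    (hY : IsSatBelow Y.1 n) {k : M} (hk : Mem k n) (p s : M) :
    opair k (opair p s) ∈ X.1 ↔ opair k (opair p s) ∈ Y.1 := by
  by_contra hcon
  obtain ⟨m, hm, hne, hmin⟩ := exists_minimal
    (P := fun k => ∃ p s, ¬ (opair k (opair p s) ∈ X.1 ↔ opair k (opair p s) ∈ Y.1)) n
    ⟨k, hk, p, s, hcon⟩
  obtain ⟨p, s, hne⟩ := hne
  refine hne ?_
  rw [hX m hm, hY m hm]
  refine jump_congr fun l hl p s => ?_
  by_contra h
  exact hmin l hl (hn m hm l hl) ⟨p, s, h⟩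

/-- Satisfaction classes exist for all standard levels. -/
theorem exists_isSatBelow (n : ℕ) : ∃ X : DefClass M, IsSatBelow X.1 (num n) := by
  induction n with
  | zero =>
    exact ⟨⟨_, FODef.definableClass (P := fun x => x ≠ x) inferInstance⟩,
      fun k hk => by simp [num] at hk⟩
  | succ n ih =>
    obtain ⟨X, hX⟩ := ih
    -- below level `n` the new class agrees with the old one
    set P : M → Prop := fun q => ∃ k p s, q = opair k (opair p s) ∧
      ((Mem k (num n) ∧ q ∈ X.1) ∨ (k = num n ∧ Jump X.1 k p s)) with hP
    refine ⟨⟨{q | P q}, FODef.definableClass (by simp only [hP]; infer_instance)⟩,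
      fun k hk p s => ?_⟩
    have key : ∀ k p s, opair k (opair p s) ∈ {q | P q} ↔
        (Mem k (num n) ∧ opair k (opair p s) ∈ X.1) ∨ (k = num n ∧ Jump X.1 k p s) := by
      intro k p s
      constructor
      · rintro ⟨k', p', s', h, h'⟩
        simp only [opair_inj] at h
        obtain ⟨rfl, rfl, rfl⟩ := h
        exact h'
      · exact fun h => ⟨k, p, s, rfl, h⟩
    have hlow : ∀ m, Mem m (num n) → ∀ p s, opair m (opair p s) ∈ {q | P q} ↔
        opair m (opair p s) ∈ X.1 := by
      intro m hm p s
      rw [key]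
      constructor
      · rintro (h | ⟨rfl, _⟩)
        · exact h.2
        · exact (irrefl _ hm).elim
      · exact fun h => Or.inl ⟨hm, h⟩
    change opair k (opair p s) ∈ {q | P q} ↔ Jump {q | P q} k p s
    rcases mem_succ.1 hk with hk | rfl
    · rw [hlow k hk, hX k hk]
      exact (jump_congr fun m hm p s =>
        hlow m (trans_of_mem_omega (num_mem_omega n) k hk m hm) p s).symm
    · rw [key, jump_congr fun m hm p s => hlow m hm p s]
      simp [irrefl]

theorem exists_upd (s c y : M) : ∃ s', Upd s c y s' := by
  refine ⟨theSet fun q => q = opair c y ∨ (Mem q s ∧ ∀ z, q ≠ opair c z), fun i z => ?_⟩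
  rw [mem_theSet (small_of_subset (cup s (upair (opair c y) (opair c y))) ?_)]
  · simp only [opair_inj, ne_eq, not_and]
    refine or_congr_right ⟨fun h => ⟨fun hi => h.2 z hi rfl, h.1⟩,
      fun h => ⟨h.2, fun _ hi => (h.1 hi).elim⟩⟩
  · rintro q (rfl | h)
    · simp
    · simp [h.1]

/-- The assignment `s` represents the values `v` of the free variable and `xs` of the bound
variables: the free variable has index `0`, the bound variable `j` has index `j + 1`. -/
def Represents {m : ℕ} (s : M) (v : Fin 1 → M) (xs : Fin m → M) : Prop :=
  ∀ i z, Mem (opair i z) s ↔ (i = num 0 ∧ z = v 0) ∨ ∃ j : Fin m, i = num (j + 1) ∧ z = xs j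

theorem Represents.upd {m : ℕ} {s : M} {v : Fin 1 → M} {xs : Fin m → M} (h : Represents s v xs)
    {y s' : M} (hs : Upd s (num (m + 1)) y s') :
    Represents s' v (Fin.snoc xs y : Fin (m + 1) → M) := by
  intro i z
  rw [hs, h]
  constructor
  · rintro (⟨rfl, rfl⟩ | ⟨_, ⟨rfl, rfl⟩ | ⟨j, rfl, rfl⟩⟩)
    · exact Or.inr ⟨Fin.last m, by simp, by simp⟩
    · exact Or.inl ⟨rfl, rfl⟩
    · exact Or.inr ⟨j.castSucc, by simp, by simp⟩
  · rintro (⟨rfl, rfl⟩ | ⟨j, rfl, rfl⟩)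
    · exact Or.inr ⟨by simp, Or.inl ⟨rfl, rfl⟩⟩
    · induction j using Fin.lastCases with
      | last => simp
      | cast j =>
        refine Or.inr ⟨?_, Or.inr ⟨j, by simp, by simp⟩⟩
        have := j.2
        simp only [Fin.val_castSucc, ne_eq, num_inj]
        omega

theorem exists_term_code {m : ℕ} (t : urLang.Term (((Set.univ : Set M) ⊕ Fin 1) ⊕ Fin m)) :
    ∃ b : M, ∀ v xs s, Represents s v xs →
      ∀ z, Val b s z ↔ z = t.realize (Sum.elim (Sum.elim (↑) v) xs) := by
  rcases t with ((a | i) | j) | f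
  · exact ⟨opair (num 0) a, fun v xs s _ z => by simp [Val, eq_comm]⟩
  · refine ⟨opair (num 1) (num 0), fun v xs s h z => ?_⟩
    obtain rfl : i = 0 := Subsingleton.elim _ _
    simp [Val, h _ _]
  · refine ⟨opair (num 1) (num (j + 1)), fun v xs s h z => ?_⟩
    simp [Val, h _ _, Fin.val_inj]
  · exact f.elim

/-- Every formula with parameters has a code of standard level. -/
theorem exists_code {m : ℕ} (φ : urLang.BoundedFormula ((Set.univ : Set M) ⊕ Fin 1) m) :
    ∃ (k : ℕ) (p : M), ∀ (X : Set M) (n : ℕ), IsSatBelow X (num n) → k < n →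
      ∀ (v : Fin 1 → M) (xs : Fin m → M) (s : M), Represents s v xs →
        (opair (num k) (opair p s) ∈ X ↔ φ.Realize (Sum.elim (↑) v) xs) := by
  induction φ with
  | falsum =>
    refine ⟨0, opair (num 5) emp, fun X n hX hn v xs s _ => ?_⟩
    rw [hX _ (num_mem_num.2 hn)]
    simp [Jump, Language.BoundedFormula.Realize]
  | equal t₁ t₂ =>
    obtain ⟨b₁, h₁⟩ := exists_term_code t₁
    obtain ⟨b₂, h₂⟩ := exists_term_code t₂
    refine ⟨0, opair (num 1) (opair b₁ b₂), fun X n hX hn v xs s hs => ?_⟩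
    rw [hX _ (num_mem_num.2 hn)]
    simp [Jump, SatEq, h₁ v xs s hs, h₂ v xs s hs, Language.BoundedFormula.Realize,
      eq_comm]
  | rel R ts =>
    cases R with
    | mem =>
      obtain ⟨b₁, h₁⟩ := exists_term_code (ts 0)
      obtain ⟨b₂, h₂⟩ := exists_term_code (ts 1)
      refine ⟨0, opair (num 0) (opair b₁ b₂), fun X n hX hn v xs s hs => ?_⟩
      rw [hX _ (num_mem_num.2 hn)]
      have : (fun i => (ts i).realize (Sum.elim (Sum.elim (↑) v) xs)) =
          ![(ts 0).realize (Sum.elim (Sum.elim (↑) v) xs),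
            (ts 1).realize (Sum.elim (Sum.elim (↑) v) xs)] := by
        ext i; fin_cases i <;> rfl
      simp [Jump, SatMem, h₁ v xs s hs, h₂ v xs s hs, Language.BoundedFormula.Realize, this, Mem]
    | ur =>
      obtain ⟨b₁, h₁⟩ := exists_term_code (ts 0)
      refine ⟨0, opair (num 2) (opair b₁ b₁), fun X n hX hn v xs s hs => ?_⟩
      rw [hX _ (num_mem_num.2 hn)]
      have : (fun i => (ts i).realize (Sum.elim (Sum.elim (↑) v) xs)) =
          ![(ts 0).realize (Sum.elim (Sum.elim (↑) v) xs)] := by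
        ext i; fin_cases i; rfl
      simp [Jump, SatUr, h₁ v xs s hs, Language.BoundedFormula.Realize, this, IsUr]
  | imp φ ψ ih₁ ih₂ =>
    obtain ⟨k₁, p₁, h₁⟩ := ih₁
    obtain ⟨k₂, p₂, h₂⟩ := ih₂
    refine ⟨max k₁ k₂ + 1, opair (num 3) (opair (opair (num k₁) p₁) (opair (num k₂) p₂)),
      fun X n hX hn v xs s hs => ?_⟩
    rw [hX _ (num_mem_num.2 hn), Language.BoundedFormula.realize_imp,
      ← h₁ X n hX (by omega) v xs s hs, ← h₂ X n hX (by omega) v xs s hs]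
    simp only [Jump, opair_inj, num_inj]
    have l₁ : k₁ < max k₁ k₂ + 1 := by omega
    have l₂ : k₂ < max k₁ k₂ + 1 := by omega
    constructor
    · rintro ⟨a, b, h⟩
      obtain ⟨rfl, rfl, h⟩ : opair (num k₁) p₁ = a ∧ opair (num k₂) p₂ = b ∧
        SatImp X (num (max k₁ k₂ + 1)) s a b := by simpa [and_assoc] using h
      obtain ⟨m, a', n, b', ha, hb, _, _, h⟩ := h
      obtain ⟨rfl, rfl⟩ := opair_inj.1 ha
      obtain ⟨rfl, rfl⟩ := opair_inj.1 hb
      exact h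
    · intro h
      exact ⟨_, _, Or.inr (Or.inr (Or.inr (Or.inl ⟨⟨trivial, rfl, rfl⟩, _, _, _, _, rfl, rfl,
        num_mem_num.2 l₁, num_mem_num.2 l₂, h⟩)))⟩
  | @all m φ ih =>
    obtain ⟨k, p, h⟩ := ih
    refine ⟨k + 1, opair (num 4) (opair (opair (num k) p) (num (m + 1))),
      fun X n hX hn v xs s hs => ?_⟩
    rw [hX _ (num_mem_num.2 hn), Language.BoundedFormula.realize_all]
    have hall : UpdAll X (num k) p s (num (m + 1)) ↔
        ∀ a, φ.Realize (Sum.elim (↑) v) (Fin.snoc xs a : Fin (m + 1) → M) := by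
      constructor
      · intro H y
        obtain ⟨s', hs'⟩ := exists_upd s (num (m + 1)) y
        exact (h X n hX (by omega) v _ s' (hs.upd hs')).1 (H y s' hs')
      · exact fun H y s' hs' => (h X n hX (by omega) v _ s' (hs.upd hs')).2 (H y)
    rw [← hall]
    simp only [Jump, opair_inj, num_inj]
    constructor
    · rintro ⟨a, b, h⟩
      obtain ⟨rfl, rfl, h⟩ : opair (num k) p = a ∧ num (m + 1) = b ∧
        SatAll X (num (k + 1)) s a b := by simpa [and_assoc] using h
      obtain ⟨m, a', ha, _, h⟩ := h
      obtain ⟨rfl, rfl⟩ := opair_inj.1 ha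
      exact h
    · intro h
      exact ⟨_, _, Or.inr (Or.inr (Or.inr (Or.inr ⟨⟨trivial, rfl, rfl⟩, _, _, rfl,
        num_mem_num.2 (Nat.lt_succ_self k), h⟩)))⟩

/-- Every definable class is defined by a code of standard level. -/
theorem exists_defines (Y : DefClass M) : ∃ (n : ℕ) (p : M), ∀ X : Set M,
    IsSatBelow X (succ (num n)) → Defines X (num n) p Y.1 := by
  obtain ⟨φ, hφ⟩ := Set.definable_iff_exists_formula_sum.1 Y.2
  obtain ⟨k, p, h⟩ := exists_code φ
  refine ⟨k, p, fun X hX x => ?_⟩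
  have key := Set.ext_iff.1 hφ fun _ => x
  simp only [Set.mem_ofPred_eq] at key
  rw [key, h X (k + 1) hX (Nat.lt_succ_self k) (fun _ => x) default (single x) ?_]
  · rfl
  · intro i z
    simp [single, num]

end Satisfaction

end UrelementSetTheory

/-! ### A definable map from the set of urelements -/

namespace UrelementSetTheory

section Abstraction

variable {M : Type u} [urLang.Structure M] [hM : ZFUR M]

/-- Some code of level `n` defines `Y`. -/
def HasCode (X : Set M) (n : M) (Y : Set M) : Prop := ∃ p, Defines X n p Y

/-- The set of the codes of level `n` for `Y` that have least rank. -/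
noncomputable def codeSet (X : Set M) (n : M) (Y : Set M) : M :=
  theSet fun p => LeastDefines X n Y p

instance FODef.hasCodeI {Γ : Type u} [Ctx M Γ] {n : Γ → M} [FOTerm n] {X Y : Γ → Set M}
    [FOClass X] [FOClass Y] : FODef fun γ => HasCode (X γ) (n γ) (Y γ) := by
  unfold HasCode; infer_instance

instance FOTerm.codeSetI {Γ : Type u} [Ctx M Γ] {n : Γ → M} [FOTerm n] {X Y : Γ → Set M}
    [FOClass X] [FOClass Y] : FOTerm fun γ => codeSet (X γ) (n γ) (Y γ) := by
  unfold codeSet; infer_instance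

/-- There is a satisfaction class for level `n`, and it defines `Y`. -/
def DefinableAt (Y : DefClass M) (n : M) : Prop :=
  ∃ X : DefClass M, IsSatBelow X.1 (succ n) ∧ HasCode X.1 n Y.1

/-- `y` is the abstract of the class `Y`: the pair of the least `n ∈ ω` such that `Y` is definable
at level `n` and the set of the codes of level `n` for `Y` that have least rank. -/
def IsAbstract (Y : DefClass M) (y : M) : Prop :=
  ∃ n, (Mem n omega ∧ ∀ m, Mem m n → ¬ DefinableAt Y m) ∧
    ∃ X : DefClass M, IsSatBelow X.1 (succ n) ∧ HasCode X.1 n Y.1 ∧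
      y = opair n (codeSet X.1 n Y.1)

omit hM in
theorem SODef.exI {Γ : Type u} [Ctx M Γ] {P : Γ → M → Prop}
    (h : SODef fun p : Γ × M => P p.1 p.2) : SODef fun γ => ∃ x, P γ x := .ex h

omit hM in
theorem SODef.exClassI {Γ : Type u} [Ctx M Γ] {P : Γ → DefClass M → Prop}
    (h : SODef fun p : Γ × DefClass M => P p.1 p.2) : SODef fun γ => ∃ X, P γ X := .exClass h

theorem soDef_isAbstract :
    SODef fun p : (SOBase M × DefClass M) × M => IsAbstract p.1.2 p.2 := by
  unfold IsAbstract
  refine SODef.exI ?_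
  refine SODef.and (SODef.and (SODef.fo inferInstance) ?_) ?_
  · have : SODef fun q : ((SOBase M × DefClass M) × M) × M =>
        ¬ ∃ m, Mem m q.2 ∧ DefinableAt q.1.1.2 m := by
      refine SODef.not (SODef.exI ?_)
      refine SODef.and (SODef.fo inferInstance) ?_
      refine SODef.exClassI (SODef.fo ?_)
      have : FOClass fun p : ((((SOBase M × DefClass M) × M) × M) × M) × DefClass M =>
          p.1.1.1.1.2.1 := FOClass.v0.weaken'.weaken'.weaken'.weakenClass'
      infer_instance
    simpa only [not_exists, not_and] using this
  · refine SODef.exClassI (SODef.fo ?_)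
    have : FOClass fun p : (((SOBase M × DefClass M) × M) × M) × DefClass M => p.1.1.1.2.1 :=
      FOClass.v0.weaken'.weaken'.weakenClass'
    have : FOTerm fun p : (((SOBase M × DefClass M) × M) × M) × DefClass M => p.1.1.2 :=
      FOTerm.v1.weakenClass'
    infer_instance

theorem leastDefines_iff_of_isSatBelow {X X' : DefClass M} {n : M} (hn : Mem n omega)
    (hX : IsSatBelow X.1 (succ n)) (hX' : IsSatBelow X'.1 (succ n)) (Y : Set M) (p : M) :
    LeastDefines X.1 n Y p ↔ LeastDefines X'.1 n Y p := by
  have h : ∀ q, Defines X.1 n q Y ↔ Defines X'.1 n q Y := fun q =>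
    forall_congr' fun x => iff_congr Iff.rfl <|
      hX.unique (trans_of_mem_omega (succ_mem_omega hn)) hX' (by simp) q (single x)
  simp only [LeastDefines, h]

theorem IsAbstract.right_unique {Y : DefClass M} {y y' : M} (h : IsAbstract Y y)
    (h' : IsAbstract Y y') : y = y' := by
  obtain ⟨n, ⟨hn, hmin⟩, X, hX, hp, rfl⟩ := h
  obtain ⟨n', ⟨hn', hmin'⟩, X', hX', hp', rfl⟩ := h'
  obtain rfl : n = n' := by
    rcases omega_trichotomy hn hn' with h | h | h
    · exact (hmin' n h ⟨X, hX, hp⟩).elim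
    · exact h
    · exact (hmin n' h ⟨X', hX', hp'⟩).elim
  simp only [codeSet, leastDefines_iff_of_isSatBelow hn hX hX']

theorem exists_isAbstract (Y : DefClass M) : ∃ y, IsAbstract Y y := by
  classical
  -- only standard levels matter, so the least level exists although `DefinableAt` is not
  -- first-order
  have h : ∃ n : ℕ, DefinableAt Y (num n) := by
    obtain ⟨n, p, hp⟩ := exists_defines Y
    obtain ⟨X, hX⟩ := exists_isSatBelow (M := M) (n + 1)
    exact ⟨n, X, hX, p, hp X.1 hX⟩
  obtain ⟨X, hX, hp⟩ := Nat.find_spec h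
  refine ⟨_, num (Nat.find h), ⟨num_mem_omega _, fun m hm => ?_⟩, X, hX, hp, rfl⟩
  obtain ⟨k, hk, rfl⟩ := mem_num.1 hm
  exact Nat.find_min h hk

theorem IsAbstract.left_unique (hA : UrelementsFormSet M) {Y Y' : DefClass M} {y : M}
    (h : IsAbstract Y y) (h' : IsAbstract Y' y) : Y = Y' := by
  obtain ⟨n, ⟨hn, _⟩, X, hX, ⟨p, hp⟩, rfl⟩ := h
  obtain ⟨n', ⟨_, _⟩, X', hX', _, h⟩ := h'
  obtain ⟨rfl, h⟩ := opair_inj.1 h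
  simp only [codeSet, ← leastDefines_iff_of_isSatBelow hn hX hX'] at h
  have hS : ∀ Z : DefClass M, Small fun p => LeastDefines X.1 n Z.1 p := fun Z =>
    small_least_level hA (P := fun p => Defines X.1 n p Z.1)
  obtain ⟨q, hq⟩ := exists_least_level hA (P := fun p => Defines X.1 n p Y.1) hp
  have hq' : LeastDefines X.1 n Y'.1 q := by
    rw [← mem_theSet (hS Y'), ← h, mem_theSet (hS Y)]
    exact hq
  exact Subtype.ext (Set.ext fun x => (hq.1 x).trans (hq'.1 x).symm)

/-- If the urelements form a set, there is a definable map that fulfills Basic Law V. -/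
theorem exists_isDefinableMap (hA : UrelementsFormSet M) :
    ∃ ε : DefClass M → M, IsDefinableMap ε ∧ FulfillsBLV ε := by
  choose ε hε using exists_isAbstract (M := M)
  refine ⟨ε, SODef.isDefinableMap ?_, fun X Y => ⟨fun h => ?_, fun h => ?_⟩⟩
  · convert soDef_isAbstract (M := M) using 3 with p
    exact ⟨fun h => h ▸ hε _, fun h => (hε _).right_unique h⟩
  · obtain rfl := (hε X).left_unique hA (h ▸ hε Y)
    exact fun _ => Iff.rfl
  · rw [Subtype.ext (Set.ext h)]

end Abstraction

end UrelementSetTheory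

/-! ### Automorphisms induced by involutions of the urelements -/

namespace UrelementSetTheory

open FirstOrder

section Automorphisms

variable {M : Type u} [urLang.Structure M]

variable (M) in
/-- A definable involution of the class of urelements (its values at sets are irrelevant). -/
structure UrInvolution where
  toFun : M → M
  foTerm : FOTerm fun p : FOBase M × M => toFun p.2
  isUr : ∀ z, IsUr z → IsUr (toFun z)
  invol : ∀ z, IsUr z → toFun (toFun z) = z

variable [hM : ZFUR M]

namespace UrInvolution

variable (π : UrInvolution M)

open Classical in
/-- The step of the recursion that extends `π` to all objects. -/
noncomputable def step (x Y : M) : M := if IsUr x then π.toFun x else Y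

/-- The extension of an involution of the urelements to the whole model, by recursion along
membership: a set `x` is mapped to `{π y : y ∈ x}`. -/
noncomputable def ext (x : M) : M := recF π.step x

section Definability

variable {Γ : Type u} [Ctx M Γ] [FOCtx M Γ] {s t : Γ → M} [FOTerm s] [FOTerm t]

instance toFunI : FOTerm fun γ => π.toFun (t γ) := FOTerm.fn π.foTerm t

instance stepI : FOTerm fun γ => π.step (s γ) (t γ) := by
  unfold step; classical exact FOTerm.ite

instance extI : FOTerm fun γ => π.ext (t γ) := by
  have : FOTerm fun p : (FOBase M × M) × M => π.step p.1.2 p.2 := inferInstance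
  exact FOTerm.recF this

end Definability

theorem ext_of_isUr {x : M} (hx : IsUr x) : π.ext x = π.toFun x := by
  rw [ext, recF_eq, step, if_pos hx]

theorem ext_of_isSet {x : M} (hx : IsSet x) : π.ext x = img (fun y => π.ext y) x := by
  rw [ext, recF_eq, step, if_neg hx]
  rfl

theorem isUr_ext {x : M} : IsUr (π.ext x) ↔ IsUr x := by
  by_cases hx : IsUr x
  · simp only [hx, π.ext_of_isUr hx, π.isUr x hx]
  · simp only [hx, iff_false, π.ext_of_isSet hx]
    exact isSet_theSet _

theorem mem_ext_of_isSet {x z : M} (hx : IsSet x) :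
    Mem z (π.ext x) ↔ ∃ y, Mem y x ∧ z = π.ext y := by
  rw [π.ext_of_isSet hx, mem_img]

theorem ext_ext (x : M) : π.ext (π.ext x) = x := by
  refine eps_induction (P := fun x => π.ext (π.ext x) = x) ?_ x
  intro x ih
  by_cases hx : IsUr x
  · rw [π.ext_of_isUr hx, π.ext_of_isUr (π.isUr x hx), π.invol x hx]
  · have hx' : IsSet (π.ext x) := fun h => hx (π.isUr_ext.1 h)
    refine set_ext (fun h => hx' (π.isUr_ext.1 h)) hx fun z => ?_
    rw [π.mem_ext_of_isSet hx']
    constructor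
    · rintro ⟨y, hy, rfl⟩
      obtain ⟨w, hw, rfl⟩ := (π.mem_ext_of_isSet hx).1 hy
      rwa [ih w hw]
    · exact fun hz => ⟨_, (π.mem_ext_of_isSet hx).2 ⟨z, hz, rfl⟩, (ih z hz).symm⟩

theorem mem_ext_ext_of_mem {x y : M} (h : Mem y x) : Mem (π.ext y) (π.ext x) :=
  (π.mem_ext_of_isSet (isSet_of_mem h)).2 ⟨y, h, rfl⟩

theorem mem_ext_ext {x y : M} : Mem (π.ext y) (π.ext x) ↔ Mem y x := by
  refine ⟨fun h => ?_, π.mem_ext_ext_of_mem⟩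
  simpa only [ext_ext] using π.mem_ext_ext_of_mem h

theorem mem_ext_iff {x z : M} : Mem z (π.ext x) ↔ Mem (π.ext z) x := by
  rw [← π.mem_ext_ext, ext_ext]

theorem ext_eq_self {t : M} (ht : Trans t) (hπ : ∀ z, Mem z t → IsUr z → π.toFun z = z) {x : M}
    (hx : Mem x t) : π.ext x = x := by
  refine eps_induction (P := fun x => Mem x t → π.ext x = x) ?_ x hx
  intro x ih hx
  by_cases hxu : IsUr x
  · rw [π.ext_of_isUr hxu, hπ x hx hxu]
  · refine set_ext (fun h => hxu (π.isUr_ext.1 h)) hxu fun z => ?_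
    rw [π.mem_ext_of_isSet hxu]
    constructor
    · rintro ⟨y, hy, rfl⟩
      rwa [ih y hy (ht x hx y hy)]
    · exact fun hz => ⟨z, hz, (ih z hz (ht x hx z hz)).symm⟩

/-- The automorphism of the model induced by an involution of the urelements. -/
noncomputable def aut : M ≃[urLang] M where
  toFun := π.ext
  invFun := π.ext
  left_inv := π.ext_ext
  right_inv := π.ext_ext
  map_fun' := fun f => f.elim
  map_rel' := by
    rintro _ (_ | _) x
    · have h := π.mem_ext_ext (x := x 1) (y := x 0)
      unfold Mem at h
      convert h using 2 <;> (ext i; fin_cases i <;> rfl)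
    · have h := π.isUr_ext (x := x 0)
      unfold IsUr at h
      convert h using 2 <;> (ext i; fin_cases i; rfl)

/-- The image of a definable class under the induced automorphism. As that automorphism is its own
inverse, the image may be taken as a preimage. -/
def mapClass (X : DefClass M) : DefClass M :=
  ⟨{x | π.ext x ∈ X.1}, FODef.definableClass inferInstance⟩

theorem mem_mapClass {X : DefClass M} {x : M} : x ∈ (π.mapClass X).1 ↔ π.ext x ∈ X.1 := Iff.rfl

theorem mapClass_mapClass (X : DefClass M) : π.mapClass (π.mapClass X) = X :=
  Subtype.ext (Set.ext fun x => by rw [mem_mapClass, mem_mapClass, ext_ext])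

/-- The action on objects and classes. -/
noncomputable def act : WithClasses M → WithClasses M := Sum.map π.ext π.mapClass

theorem act_act (a : WithClasses M) : π.act (π.act a) = a := by
  rcases a with a | a <;> simp [act, ext_ext, mapClass_mapClass]

theorem act_eq_inl {a : WithClasses M} {x : M} :
    π.act a = Sum.inl x ↔ a = Sum.inl (π.ext x) := by
  constructor
  · intro h
    rw [← π.act_act a, h]
    rfl
  · rintro rfl
    simp [act, ext_ext]

theorem act_eq_inr {a : WithClasses M} {X : DefClass M} :
    π.act a = Sum.inr X ↔ a = Sum.inr (π.mapClass X) := by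
  constructor
  · intro h
    rw [← π.act_act a, h]
    rfl
  · rintro rfl
    simp [act, mapClass_mapClass]

/-- The automorphism of the two-sorted structure induced by an involution of the urelements. -/
noncomputable def autWithClasses : WithClasses M ≃[classLang] WithClasses M where
  toFun := π.act
  invFun := π.act
  left_inv := π.act_act
  right_inv := π.act_act
  map_fun' := fun f => f.elim
  map_rel' := by
    rintro _ (_ | _ | _ | _) v
    · change (∃ x y : M, π.act (v 0) = _ ∧ π.act (v 1) = _ ∧ _) ↔ ∃ x y : M, _
      simp only [act_eq_inl]
      constructor
      · rintro ⟨x, y, h, h', hxy⟩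
        exact ⟨_, _, h, h', π.mem_ext_ext.2 hxy⟩
      · rintro ⟨x, y, h, h', hxy⟩
        exact ⟨π.ext x, π.ext y, by rwa [ext_ext], by rwa [ext_ext], π.mem_ext_ext.2 hxy⟩
    · change (∃ x : M, π.act (v 0) = _ ∧ _) ↔ ∃ x : M, _
      simp only [act_eq_inl]
      constructor
      · rintro ⟨x, h, hx⟩
        exact ⟨_, h, π.isUr_ext.2 hx⟩
      · rintro ⟨x, h, hx⟩
        exact ⟨π.ext x, by rwa [ext_ext], π.isUr_ext.2 hx⟩
    · change (∃ X : DefClass M, π.act (v 0) = _) ↔ ∃ X : DefClass M, _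
      simp only [act_eq_inr]
      constructor
      · rintro ⟨X, h⟩
        exact ⟨_, h⟩
      · rintro ⟨X, h⟩
        exact ⟨π.mapClass X, by rwa [mapClass_mapClass]⟩
    · change (∃ (x : M) (X : DefClass M), π.act (v 0) = _ ∧ π.act (v 1) = _ ∧ _) ↔
        ∃ (x : M) (X : DefClass M), _
      simp only [act_eq_inl, act_eq_inr]
      constructor
      · rintro ⟨x, X, h, h', hx⟩
        exact ⟨_, _, h, h', by rwa [mem_mapClass, ext_ext]⟩
      · rintro ⟨x, X, h, h', hx⟩
        exact ⟨π.ext x, π.mapClass X, by rwa [ext_ext], by rwa [mapClass_mapClass],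
          by rwa [mem_mapClass, ext_ext]⟩

/-- `π` fixes the urelements that are members of `s`. -/
def Fixes (s : M) : Prop := ∀ z, Mem z s → IsUr z → π.toFun z = z

end UrInvolution

theorem definable_aut_invariant {L : FirstOrder.Language.{0, 0}} {N : Type u} [L.Structure N]
    (σ : N ≃[L] N) {A : Set N} (hA : ∀ a ∈ A, σ a = a) {α : Type} {S : Set (α → N)}
    (hS : A.Definable L S) (v : α → N) : σ ∘ v ∈ S ↔ v ∈ S := by
  obtain ⟨φ, rfl⟩ := Set.definable_iff_exists_formula_sum.1 hS
  simp only [Set.mem_ofPred_eq]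
  rw [← Language.StrongHomClass.realize_formula σ φ (v := Sum.elim (↑) v)]
  congr! 1
  ext i
  rcases i with a | i
  · exact (hA a a.2).symm
  · rfl

/-- The object or class `a` is fixed by every automorphism induced by an involution that fixes the
urelements in `s`. -/
def Supports (s : M) (a : WithClasses M) : Prop := ∀ π : UrInvolution M, π.Fixes s → π.act a = a

theorem exists_supports_finset (F : Finset (WithClasses M))
    (h : ∀ a ∈ F, ∃ s : M, Supports s a) : ∃ s : M, ∀ a ∈ F, Supports s a := by
  classical
  induction F using Finset.induction_on with
  | empty => exact ⟨emp, by simp⟩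
  | insert a F _ ih =>
    obtain ⟨s, hs⟩ := ih fun b hb => h b (Finset.mem_insert_of_mem hb)
    obtain ⟨t, ht⟩ := h a (Finset.mem_insert_self a F)
    refine ⟨cup s t, fun b hb π hπ => ?_⟩
    rcases Finset.mem_insert.1 hb with rfl | hb
    · exact ht π fun z hz => hπ z (by simp [hz])
    · exact hs b hb π fun z hz => hπ z (by simp [hz])

theorem exists_supports_obj (x : M) : ∃ s : M, Supports s (Sum.inl x) := by
  obtain ⟨t, ht, hx⟩ := exists_trans x
  exact ⟨t, fun π hπ => by simp [UrInvolution.act, π.ext_eq_self ht hπ hx]⟩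

/-- Classes have supports because they are defined from finitely many objects. -/
theorem exists_supports (a : WithClasses M) : ∃ s : M, Supports s a := by
  classical
  rcases a with x | X
  · exact exists_supports_obj x
  · obtain ⟨A, _, hA⟩ := Set.definable_iff_finitely_definable.1 X.2
    obtain ⟨s, hs⟩ := exists_supports_finset (A.image Sum.inl) (by
      intro a ha
      obtain ⟨x, _, rfl⟩ := Finset.mem_image.1 ha
      exact exists_supports_obj x)
    refine ⟨s, fun π hπ => ?_⟩
    have hfix : ∀ a ∈ (A : Set M), π.aut a = a := fun a ha =>
      Sum.inl_injective (hs (Sum.inl a) (Finset.mem_image_of_mem _ ha) π hπ)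
    have key : π.mapClass X = X := Subtype.ext (Set.ext fun x =>
      definable_aut_invariant π.aut hfix hA fun _ => x)
    simp [UrInvolution.act, key]

/-- A parametrically definable map commutes with all automorphisms that fix a suitable set of
urelements. -/
theorem exists_forall_ext_eq {ε : DefClass M → M} (hε : IsParamDefinableMap ε) :
    ∃ s : M, ∀ π : UrInvolution M, π.Fixes s → ∀ X, π.ext (ε X) = ε (π.mapClass X) := by
  obtain ⟨A, _, hA⟩ := Set.definable_iff_finitely_definable.1 hε
  obtain ⟨s, hs⟩ := exists_supports_finset A fun a _ => exists_supports a
  refine ⟨s, fun π hπ X => ?_⟩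
  have h := (definable_aut_invariant π.autWithClasses (fun a ha => hs a ha π hπ) hA
    ![Sum.inr X, Sum.inl (ε X)]).2 ⟨X, rfl⟩
  obtain ⟨Y, hY⟩ := h
  rw [Prod.mk.injEq] at hY
  have h₁ : (Sum.inr (π.mapClass X) : WithClasses M) = Sum.inr Y := hY.1
  have h₂ : (Sum.inl (π.ext (ε X)) : WithClasses M) = Sum.inl (ε Y) := hY.2
  rw [Sum.inl_injective h₂, Sum.inr_injective h₁]

end Automorphisms

end UrelementSetTheory

/-! ### Countable choice and infinite sets of urelements -/

namespace UrelementSetTheory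

section Choice

variable {M : Type u} [urLang.Structure M] [hM : ZFUR M]

theorem isOmega_omega : IsOmega (omega : M) := ⟨isSet_theSet _, fun _ => mem_omega⟩

theorem app_spec {f x : M} (h : ∃! y, Mem (opair x y) f) : Mem (opair x (app f x)) f :=
  iota_spec h

/-- Countable choice for definable relations. Collection reduces it to countable choice for
sets. -/
theorem exists_choice (hColl : Collection M) (hACω : CountableChoice M) {R : M → M → Prop}
    [hR : FODef fun p : (FOBase M × M) × M => R p.1.2 p.2]
    (h : ∀ n, Mem n omega → ∃ y, R n y) : ∃ H : M, ∀ n, Mem n omega → R n (app H n) := by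
  have inst : ∀ {Γ : Type u} [Ctx M Γ] [FOCtx M Γ] (s t : Γ → M) [FOTerm s] [FOTerm t],
      FODef fun γ => R (s γ) (t γ) := fun s t => FODef.pred₂ hR s t
  obtain ⟨v, hv⟩ := hColl R hR.definableRel omega h
  -- tagging by `n` makes the family of the candidate sets `E n` injective in `n`
  set E : M → M := fun n => theSet fun q => ∃ y, Mem y v ∧ R n y ∧ q = opair n y with hE
  have instE : FOTerm fun p : FOBase M × M => E p.2 := by simp only [hE]; infer_instance
  have instE' : ∀ {Γ : Type u} [Ctx M Γ] [FOCtx M Γ] (t : Γ → M) [FOTerm t],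
      FOTerm fun γ => E (t γ) := fun t => FOTerm.fn instE t
  have memE : ∀ {n q}, Mem q (E n) ↔ ∃ y, Mem y v ∧ R n y ∧ q = opair n y := by
    intro n q
    refine mem_theSet (small_of_subset (img (fun y => opair n y) v) ?_)
    rintro z ⟨y, hy, _, rfl⟩
    exact mem_img.2 ⟨y, hy, rfl⟩
  have neE : ∀ {n}, Mem n omega → ∃ q, Mem q (E n) := by
    intro n hn
    obtain ⟨y, hy, hR⟩ := hv n hn
    exact ⟨_, memE.2 ⟨y, hy, hR, rfl⟩⟩
  have injE : ∀ {n n'}, Mem n omega → E n = E n' → n = n' := by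
    intro n n' hn hnn'
    obtain ⟨q, hq⟩ := neE hn
    obtain ⟨y, _, _, rfl⟩ := memE.1 hq
    rw [hnn'] at hq
    obtain ⟨y', _, _, h⟩ := memE.1 hq
    exact (opair_inj.1 h).1
  have memF : ∀ {a b}, Mem (opair a b) (img (fun n => opair (E n) n) omega) ↔
      Mem b omega ∧ a = E b := by
    intro a b
    rw [mem_img]
    constructor
    · rintro ⟨n, hn, h⟩
      obtain ⟨rfl, rfl⟩ := opair_inj.1 h
      exact ⟨hn, rfl⟩
    · rintro ⟨hb, rfl⟩
      exact ⟨b, hb, rfl⟩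
  have hcount : IsCountable (img E omega) := by
    refine ⟨omega, img (fun n => opair (E n) n) omega, isOmega_omega, ⟨isSet_theSet _, ?_, ?_⟩,
      ?_, ?_⟩
    · intro p hp
      obtain ⟨n, hn, rfl⟩ := mem_img.1 hp
      exact ⟨E n, n, mem_img.2 ⟨n, hn, rfl⟩, isOrdPair_iff.2 rfl⟩
    · intro a ha
      obtain ⟨n, hn, rfl⟩ := mem_img.1 ha
      refine ⟨n, pairMem_iff.2 (memF.2 ⟨hn, rfl⟩), fun m hm => ?_⟩
      exact (injE hn (memF.1 (pairMem_iff.1 hm)).2).symm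
    · exact fun a b hab => (memF.1 (pairMem_iff.1 hab)).1
    · intro a a' b hab hab'
      rw [(memF.1 (pairMem_iff.1 hab)).2, (memF.1 (pairMem_iff.1 hab')).2]
  obtain ⟨c, ⟨_, _, hc⟩, hc'⟩ := hACω (img E omega) (isSet_theSet _) hcount (by
    intro y hy
    obtain ⟨n, hn, rfl⟩ := mem_img.1 hy
    exact ⟨isSet_theSet _, neE hn⟩)
  obtain ⟨H, hH⟩ := exists_app (fun n => snd (app c (E n))) omega
  refine ⟨H, fun n hn => ?_⟩
  have h₁ := hc (E n) (mem_img.2 ⟨n, hn, rfl⟩)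
  simp only [pairMem_iff] at h₁
  obtain ⟨y, _, hR, hy⟩ := memE.1 (hc' _ _ (pairMem_iff.2 (app_spec h₁)))
  rw [hH n hn, hy, snd_opair]
  exact hR

end Choice

section Injections

variable {M : Type u} [urLang.Structure M] [hM : ZFUR M]

/-- `g` restricted to `n` is injective, with values among the urelements outside `s`. -/
def InjOutside (s g n : M) : Prop :=
  ∀ k, Mem k n → (IsUr (app g k) ∧ ¬ Mem (app g k) s) ∧
    ∀ l, Mem l n → app g k = app g l → k = l

/-- `g` restricted to `n` is injective, with values in `Y`. -/
def InjInto (g n Y : M) : Prop :=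
  ∀ k, Mem k n → Mem (app g k) Y ∧ ∀ l, Mem l n → app g k = app g l → k = l

/-- Some natural number of the model does not inject into `Y`. -/
def Bounded (Y : M) : Prop := ∃ n, Mem n omega ∧ ¬ ∃ g, InjInto g n Y

/-- The least natural number of the model with the property `P`. -/
noncomputable def least (P : M → Prop) : M :=
  iota fun n => Mem n omega ∧ P n ∧ ∀ m, Mem m n → ¬ P m

/-- The first element outside `Y` in the sequence of finite sequences `H`. -/
noncomputable def pick (H Y : M) : M :=
  app (app H (least fun i => ∃ k, Mem k i ∧ ¬ Mem (app (app H i) k) Y))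
    (least fun k => Mem k (least fun i => ∃ k, Mem k i ∧ ¬ Mem (app (app H i) k) Y) ∧
      ¬ Mem (app (app H (least fun i => ∃ k, Mem k i ∧ ¬ Mem (app (app H i) k) Y)) k) Y)

section Definability

variable {Γ : Type u} [Ctx M Γ] {a b c : Γ → M} [FOTerm a] [FOTerm b] [FOTerm c]

instance FODef.injOutsideI : FODef fun γ => InjOutside (a γ) (b γ) (c γ) := by
  unfold InjOutside; infer_instance
instance FODef.injIntoI : FODef fun γ => InjInto (a γ) (b γ) (c γ) := by
  unfold InjInto; infer_instance
instance FODef.boundedI : FODef fun γ => Bounded (a γ) := by unfold Bounded; infer_instance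
instance FOTerm.leastI {P : Γ → M → Prop} [h : FODef fun p : Γ × M => P p.1 p.2] :
    FOTerm fun γ => least (P γ) := by
  have h₂ := h.weakenMid
  have h₃ : FODef fun q : ((Γ × M) × M) × M => P q.1.1.1 q.2 :=
    FODef.weakenMid (P := fun (q : Γ × M) z => P q.1 z) h₂
  unfold least
  infer_instance
instance FOTerm.pickI : FOTerm fun γ => pick (a γ) (b γ) := by unfold pick; infer_instance

end Definability

theorem least_spec {P : M → Prop} [hP : FODef fun p : FOBase M × M => P p.2]
    (h : ∃ n, Mem n omega ∧ P n) : Mem (least P) omega ∧ P (least P) := by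
  obtain ⟨n, hn, hPn, hmin⟩ := exists_minimal omega h
  have hmin' : ∀ m, Mem m n → ¬ P m := fun m hm => hmin m hm (trans_omega n hn m hm)
  have := iota_spec (P := fun n => Mem n omega ∧ P n ∧ ∀ m, Mem m n → ¬ P m)
    ⟨n, ⟨hn, hPn, hmin'⟩, fun m ⟨hm, hPm, hm'⟩ => by
      rcases omega_trichotomy hm hn with h | h | h
      · exact (hmin' m h hPm).elim
      · exact h
      · exact (hm' n h hPn).elim⟩
  exact ⟨this.1, this.2.1⟩

theorem pick_spec {H Y s : M} (hH : ∀ n, Mem n omega → InjOutside s (app H n) n)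
    (hY : Bounded Y) : (IsUr (pick H Y) ∧ ¬ Mem (pick H Y) s) ∧ ¬ Mem (pick H Y) Y := by
  have h₁ : ∃ i, Mem i omega ∧ ∃ k, Mem k i ∧ ¬ Mem (app (app H i) k) Y := by
    obtain ⟨n, hn, hnY⟩ := hY
    by_contra hcon
    refine hnY ⟨app H n, fun k hk => ⟨?_, (hH n hn k hk).2⟩⟩
    by_contra hkY
    exact hcon ⟨n, hn, k, hk, hkY⟩
  obtain ⟨hi, k, hk, hkY⟩ := least_spec h₁
  unfold pick
  set i := least fun i => ∃ k, Mem k i ∧ ¬ Mem (app (app H i) k) Y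
  obtain ⟨_, hl, hlY⟩ := least_spec (P := fun k => Mem k i ∧ ¬ Mem (app (app H i) k) Y)
    ⟨k, trans_omega i hi k hk, hk, hkY⟩
  exact ⟨(hH i hi _ hl).1, hlY⟩

theorem bounded_emp : Bounded (emp : M) :=
  ⟨succ emp, succ_mem_omega emp_mem_omega, fun ⟨g, hg⟩ =>
    not_mem_emp _ (hg emp (by simp)).1⟩

/-- The pigeonhole principle: if `n` does not inject into `Y`, then `n + 1` does not inject
into `Y ∪ {t}`. -/
theorem Bounded.insert {Y : M} (h : Bounded Y) (t : M) : Bounded (cup Y (upair t t)) := by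
  obtain ⟨n, hn, hnY⟩ := h
  refine ⟨succ n, succ_mem_omega hn, fun ⟨g, hg⟩ => hnY ?_⟩
  have hgY : ∀ {k}, Mem k (succ n) → app g k ≠ t → Mem (app g k) Y := fun hk hkt => by
    have := (hg _ hk).1
    simpa [hkt] using this
  have hlt : ∀ {k}, Mem k n → Mem k (succ n) := fun hk => mem_succ.2 (Or.inl hk)
  by_cases hk : ∃ k, Mem k n ∧ app g k = t
  · obtain ⟨k, hk, hkt⟩ := hk
    classical
    -- redirect the argument with value `t` to the value at the last argument `n`
    have : FOTerm fun p : FOBase M × M => if p.2 = k then app g n else app g p.2 := FOTerm.ite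
    obtain ⟨g', hg'⟩ := exists_app (fun i => if i = k then app g n else app g i) n
    have hinj : ∀ {i j}, Mem i (succ n) → Mem j (succ n) → app g i = app g j → i = j :=
      fun hi hj h => (hg _ hi).2 _ hj h
    have hnn : Mem n (succ n) := by simp
    have hne : ∀ {i}, Mem i n → i ≠ n := fun hi h => irrefl n (h ▸ hi)
    refine ⟨g', fun i hi => ⟨?_, fun j hj hij => ?_⟩⟩
    · rw [hg' i hi]
      split_ifs with hik
      · exact hgY hnn fun h => hne hk (hinj (hlt hk) hnn (hkt.trans h.symm))
      · exact hgY (hlt hi) fun h => hik (hinj (hlt hi) (hlt hk) (h.trans hkt.symm))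
    · rw [hg' i hi, hg' j hj] at hij
      split_ifs at hij with hik hjk hjk
      · rw [hik, hjk]
      · exact (hne hj (hinj hnn (hlt hj) hij).symm).elim
      · exact (hne hi (hinj (hlt hi) hnn hij)).elim
      · exact hinj (hlt hi) (hlt hj) hij
  · exact ⟨g, fun i hi => ⟨hgY (hlt hi) fun h => hk ⟨i, hi, h⟩,
      fun j hj h => (hg i (hlt hi)).2 j (hlt hj) h⟩⟩

theorem exists_isUr_not_mem (hA : ¬ UrelementsFormSet M) (x : M) : ∃ u, IsUr u ∧ ¬ Mem u x := by
  by_contra hcon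
  refine hA (small_of_subset x fun z hz => ?_)
  by_contra hzx
  exact hcon ⟨z, hz, hzx⟩

theorem exists_injOutside (hA : ¬ UrelementsFormSet M) (s : M) {n : M} (hn : Mem n omega) :
    ∃ g, InjOutside s g n := by
  refine omega_induction (P := fun n => ∃ g, InjOutside s g n) ?_ ?_ hn
  · exact ⟨emp, fun k hk => (not_mem_emp _ hk).elim⟩
  · rintro n hn ⟨g, hg⟩
    obtain ⟨u, hu, hus⟩ := exists_isUr_not_mem hA (cup s (img (fun k => app g k) n))
    simp only [mem_cup, not_or] at hus
    have hug : ∀ k, Mem k n → u ≠ app g k := fun k hk h => hus.2 (mem_img.2 ⟨k, hk, h⟩)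
    classical
    have : FOTerm fun p : FOBase M × M => if p.2 = n then u else app g p.2 := FOTerm.ite
    obtain ⟨g', hg'⟩ := exists_app (fun k => if k = n then u else app g k) (succ n)
    have hgn : app g' n = u := by rw [hg' n (by simp), if_pos rfl]
    have hgk : ∀ {k}, Mem k n → app g' k = app g k := fun {k} hk => by
      rw [hg' k (mem_succ.2 (Or.inl hk)), if_neg]
      rintro rfl
      exact irrefl k hk
    refine ⟨g', fun k hk => ?_⟩
    rcases mem_succ.1 hk with hk | rfl
    · rw [hgk hk]
      refine ⟨(hg k hk).1, fun l hl h => ?_⟩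
      rcases mem_succ.1 hl with hl | rfl
      · rw [hgk hl] at h
        exact (hg k hk).2 l hl h
      · rw [hgn] at h
        exact (hug k hk h.symm).elim
    · rw [hgn]
      refine ⟨⟨hu, hus.1⟩, fun l hl h => ?_⟩
      rcases mem_succ.1 hl with hl | rfl
      · rw [hgk hl] at h
        exact (hug l hl h).elim
      · rfl

/-- If the urelements do not form a set, then every set of urelements is disjoint from some
countably infinite set of urelements. Countable choice gives injections of all natural numbers
into the urelements outside `s`; they are merged by recursion. -/
theorem exists_injOutside_omega (hColl : Collection M) (hACω : CountableChoice M)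
    (hA : ¬ UrelementsFormSet M) (s : M) : ∃ f, InjOutside s f omega := by
  obtain ⟨H, hH⟩ := exists_choice hColl hACω (R := fun n g => InjOutside s g n)
    fun n hn => exists_injOutside hA s hn
  set Ψ : M → M → M := fun _ Y => pick H Y with hΨ
  have inst : FOTerm fun p : (FOBase M × M) × M => Ψ p.1.2 p.2 := by
    simp only [hΨ]; infer_instance
  have instR : ∀ {Γ : Type u} [Ctx M Γ] [FOCtx M Γ] (t : Γ → M) [FOTerm t],
      FOTerm fun γ => recF Ψ (t γ) := fun t => FOTerm.recF inst
  have hrec : ∀ n, recF Ψ n = pick H (img (fun m => recF Ψ m) n) := recF_eq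
  have hb : ∀ {n}, Mem n omega → Bounded (img (fun m => recF Ψ m) n) := by
    intro n hn
    refine omega_induction (P := fun n => Bounded (img (fun m => recF Ψ m) n)) ?_ ?_ hn
    · convert bounded_emp (M := M)
      exact set_ext (isSet_theSet _) isSet_emp fun z => by simp [mem_img]
    · intro n _ ih
      convert ih.insert (recF Ψ n) using 1
      refine set_ext (isSet_theSet _) (isSet_cup _ _) fun z => ?_
      simp only [mem_img, mem_cup, mem_succ, mem_upair, or_self]
      constructor
      · rintro ⟨m, hm | rfl, rfl⟩
        · exact Or.inl ⟨m, hm, rfl⟩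
        · exact Or.inr rfl
      · rintro (⟨m, hm, rfl⟩ | rfl)
        · exact ⟨m, Or.inl hm, rfl⟩
        · exact ⟨n, Or.inr rfl, rfl⟩
  have hne : ∀ {m n}, Mem n omega → Mem m n → recF Ψ m ≠ recF Ψ n := fun {m n} hn hm h => by
    refine (pick_spec hH (hb hn)).2 ?_
    rw [← hrec, ← h]
    exact mem_img.2 ⟨m, hm, rfl⟩
  obtain ⟨f, hf⟩ := exists_app (fun n => recF Ψ n) omega
  refine ⟨f, fun n hn => ⟨?_, fun m hm h => ?_⟩⟩
  · rw [hf n hn, hrec]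
    exact (pick_spec hH (hb hn)).1
  · rw [hf n hn, hf m hm] at h
    rcases omega_trichotomy hn hm with h' | h' | h'
    · exact (hne hm h' h).elim
    · exact h'
    · exact (hne hn h' h.symm).elim

end Injections

end UrelementSetTheory

/-! ### No abstraction without a set of urelements -/

namespace UrelementSetTheory

section NoAbstraction

variable {M : Type u} [urLang.Structure M]

open Classical in
/-- The transposition of two urelements. -/
noncomputable def transposition (u w : M) (hu : IsUr u) (hw : IsUr w) : UrInvolution M where
  toFun z := if z = u then w else if z = w then u else z
  foTerm := by
    have : FOTerm fun p : FOBase M × M => if p.2 = w then u else p.2 := FOTerm.ite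
    exact FOTerm.ite
  isUr z hz := by split_ifs <;> assumption
  invol z _ := by grind

theorem transposition_left {u w : M} (hu : IsUr u) (hw : IsUr w) :
    (transposition u w hu hw).toFun u = w := by simp [transposition]

theorem transposition_of_ne {u w z : M} (hu : IsUr u) (hw : IsUr w) (hzu : z ≠ u) (hzw : z ≠ w) :
    (transposition u w hu hw).toFun z = z := by simp [transposition, hzu, hzw]

variable [hM : ZFUR M]

/-- The graph of the involution that exchanges `f m` and `f' m` for all `m ∈ ω`. -/
def SwapRel (f f' z r : M) : Prop :=
  (∃ m, Mem m omega ∧ ((z = app f m ∧ r = app f' m) ∨ (z = app f' m ∧ r = app f m))) ∨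
    ((¬ ∃ m, Mem m omega ∧ (z = app f m ∨ z = app f' m)) ∧ r = z)

theorem SwapRel.symm {f f' z r : M} (h : SwapRel f f' z r) : SwapRel f f' r z := by
  rcases h with ⟨m, hm, ⟨rfl, rfl⟩ | ⟨rfl, rfl⟩⟩ | ⟨h, rfl⟩
  · exact Or.inl ⟨m, hm, Or.inr ⟨rfl, rfl⟩⟩
  · exact Or.inl ⟨m, hm, Or.inl ⟨rfl, rfl⟩⟩
  · exact Or.inr ⟨h, rfl⟩

variable {s f f' : M}

theorem swapRel_existsUnique (hf : InjOutside s f omega)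
    (hf' : InjOutside (cup s (img (fun k => app f k) omega)) f' omega) (z : M) :
    ∃! r, SwapRel f f' z r := by
  have hinj : ∀ {m n}, Mem m omega → Mem n omega → app f m = app f n → m = n :=
    fun hm hn h => (hf _ hm).2 _ hn h
  have hinj' : ∀ {m n}, Mem m omega → Mem n omega → app f' m = app f' n → m = n :=
    fun hm hn h => (hf' _ hm).2 _ hn h
  have hne : ∀ {m n}, Mem m omega → Mem n omega → app f m ≠ app f' n := fun {m n} hm hn h =>
    (hf' n hn).1.2 (mem_cup.2 (Or.inr (mem_img.2 ⟨m, hm, h.symm⟩)))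
  by_cases h : ∃ m, Mem m omega ∧ (z = app f m ∨ z = app f' m)
  · obtain ⟨m, hm, rfl | rfl⟩ := h
    · refine ⟨app f' m, Or.inl ⟨m, hm, Or.inl ⟨rfl, rfl⟩⟩, ?_⟩
      rintro r (⟨n, hn, ⟨h, rfl⟩ | ⟨h, rfl⟩⟩ | ⟨h, _⟩)
      · rw [hinj hm hn h]
      · exact (hne hm hn h).elim
      · exact (h ⟨m, hm, Or.inl rfl⟩).elim
    · refine ⟨app f m, Or.inl ⟨m, hm, Or.inr ⟨rfl, rfl⟩⟩, ?_⟩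
      rintro r (⟨n, hn, ⟨h, rfl⟩ | ⟨h, rfl⟩⟩ | ⟨h, _⟩)
      · exact (hne hn hm h.symm).elim
      · rw [hinj' hm hn h]
      · exact (h ⟨m, hm, Or.inr rfl⟩).elim
  · refine ⟨z, Or.inr ⟨h, rfl⟩, ?_⟩
    rintro r (⟨n, hn, ⟨h', rfl⟩ | ⟨h', rfl⟩⟩ | ⟨_, rfl⟩)
    · exact (h ⟨n, hn, Or.inl h'⟩).elim
    · exact (h ⟨n, hn, Or.inr h'⟩).elim
    · rfl

/-- The involution that exchanges the ranges of two injections of `ω` into the urelements. -/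
noncomputable def swap (hf : InjOutside s f omega)
    (hf' : InjOutside (cup s (img (fun k => app f k) omega)) f' omega) : UrInvolution M where
  toFun z := iota fun r => SwapRel f f' z r
  foTerm := by unfold SwapRel; infer_instance
  isUr z hz := by
    rcases iota_spec (swapRel_existsUnique hf hf' z) with
      ⟨m, hm, ⟨_, h⟩ | ⟨_, h⟩⟩ | ⟨_, h⟩ <;> rw [h]
    · exact (hf' m hm).1.1
    · exact (hf m hm).1.1
    · exact hz
  invol z _ := (swapRel_existsUnique hf hf' _).unique
    (iota_spec (swapRel_existsUnique hf hf' _)) (iota_spec (swapRel_existsUnique hf hf' z)).symm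

theorem swap_app (hf : InjOutside s f omega)
    (hf' : InjOutside (cup s (img (fun k => app f k) omega)) f' omega) {m : M}
    (hm : Mem m omega) : (swap hf hf').toFun (app f m) = app f' m :=
  (swapRel_existsUnique hf hf' _).unique (iota_spec (swapRel_existsUnique hf hf' _))
    (Or.inl ⟨m, hm, Or.inl ⟨rfl, rfl⟩⟩)

theorem swap_fixes (hf : InjOutside s f omega)
    (hf' : InjOutside (cup s (img (fun k => app f k) omega)) f' omega) :
    (swap hf hf').Fixes s := fun z hz _ =>
  (swapRel_existsUnique hf hf' _).unique (iota_spec (swapRel_existsUnique hf hf' _)) <| by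
    refine Or.inr ⟨?_, rfl⟩
    rintro ⟨m, hm, rfl | rfl⟩
    · exact (hf m hm).1.2 hz
    · exact (hf' m hm).1.2 (mem_cup.2 (Or.inl hz))

/-- The class of the objects that contain all but boundedly many terms of the sequence `f`. -/
def tailClass (f : M) : DefClass M :=
  ⟨{x | ∃ n, Mem n omega ∧ ∀ m, Mem m omega → ¬ Mem m n → Mem (app f m) x},
    FODef.definableClass inferInstance⟩

theorem mem_tailClass {f x : M} : x ∈ (tailClass f).1 ↔
    ∃ n, Mem n omega ∧ ∀ m, Mem m omega → ¬ Mem m n → Mem (app f m) x := Iff.rfl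

theorem exists_bound (hf : InjOutside s f omega) {n : M} (hn : Mem n omega) (u : M) :
    ∃ n', Mem n' omega ∧ Sub n n' ∧ ∀ m, Mem m omega → ¬ Mem m n' → app f m ≠ u := by
  by_cases h : ∃ k, Mem k omega ∧ ¬ Mem k n ∧ app f k = u
  · obtain ⟨k, hk, hkn, rfl⟩ := h
    refine ⟨succ k, succ_mem_omega hk, fun z hz => mem_succ.2 (Or.inl ?_), fun m hm hmk h => ?_⟩
    · rcases omega_trichotomy hk hn with h | rfl | h
      · exact (hkn h).elim
      · exact hz
      · exact trans_of_mem_omega hk n h z hz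
    · rw [(hf m hm).2 k hk h] at hmk
      exact hmk (by simp)
  · exact ⟨n, hn, fun _ h => h, fun m hm hmn hu => h ⟨m, hm, hmn, hu⟩⟩

/-- Transpositions change a set in at most two elements, and so preserve `tailClass f`. -/
theorem mapClass_transposition (hf : InjOutside s f omega) {u w : M} (hu : IsUr u)
    (hw : IsUr w) : (transposition u w hu hw).mapClass (tailClass f) = tailClass f := by
  set τ := transposition u w hu hw with hτ
  have key : ∀ x, x ∈ (tailClass f).1 → τ.ext x ∈ (tailClass f).1 := by
    rintro x ⟨n, hn, h⟩
    obtain ⟨n₁, hn₁, hsub₁, h₁⟩ := exists_bound hf hn u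
    obtain ⟨n₂, hn₂, hsub₂, h₂⟩ := exists_bound hf hn₁ w
    refine ⟨n₂, hn₂, fun m hm hmn => ?_⟩
    have hm₁ : ¬ Mem m n₁ := fun h => hmn (hsub₂ m h)
    rw [τ.mem_ext_iff, τ.ext_of_isUr (hf m hm).1.1, hτ,
      transposition_of_ne hu hw (h₁ m hm hm₁) (h₂ m hm hmn)]
    exact h m hm fun h => hm₁ (hsub₁ m h)
  refine Subtype.ext (Set.ext fun x => ⟨fun h => ?_, fun h => key x h⟩)
  simpa only [τ.ext_ext] using key _ (τ.mem_mapClass.1 h)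

/-- An object fixed by all transpositions of urelements outside `s` lies in a transitive set whose
urelements all belong to `s`. -/
theorem exists_trans_of_forall_transposition (hA : ¬ UrelementsFormSet M) {e : M}
    (h : ∀ u w (hu : IsUr u) (hw : IsUr w), ¬ Mem u s → ¬ Mem w s →
      (transposition u w hu hw).ext e = e) :
    ∃ t, Trans t ∧ Mem e t ∧ ∀ u, Mem u t → IsUr u → Mem u s := by
  obtain ⟨t₀, ht₀, he₀⟩ := exists_trans e
  have hmem : ∀ {z}, Mem z (theSet fun z => ∀ t, Trans t → Mem e t → Mem z t) ↔
      ∀ t, Trans t → Mem e t → Mem z t :=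
    mem_theSet (small_of_subset t₀ fun z hz => hz t₀ ht₀ he₀)
  refine ⟨theSet fun z => ∀ t, Trans t → Mem e t → Mem z t, ?_, ?_, ?_⟩
  · exact fun y hy z hz => hmem.2 fun t ht het => ht y (hmem.1 hy t ht het) z hz
  · exact hmem.2 fun t _ het => het
  · intro u hut hu
    by_contra hus
    obtain ⟨w, hw, hw'⟩ := exists_isUr_not_mem hA (cup s t₀)
    simp only [mem_cup, not_or] at hw'
    -- moving `u` out of `t₀` would fix `e` but not its transitive closure
    set τ := transposition u w hu hw with hτ
    have he : τ.ext e = e := h u w hu hw hus hw'.1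
    have ht : Trans (τ.ext t₀) := by
      intro y hy z hz
      rw [τ.mem_ext_iff] at hy ⊢
      exact ht₀ _ hy _ (τ.mem_ext_ext_of_mem hz)
    have hu' := hmem.1 hut (τ.ext t₀) ht (by rwa [τ.mem_ext_iff, he])
    rw [τ.mem_ext_iff, τ.ext_of_isUr hu, hτ, transposition_left hu hw] at hu'
    exact hw'.2 hu'

/-- If the urelements do not form a set, no parametrically definable map fulfills Basic Law V. -/
theorem urelementsFormSet_of_fulfillsBLV (hColl : Collection M) (hACω : CountableChoice M)
    {ε : DefClass M → M} (hε : IsParamDefinableMap ε) (hBLV : FulfillsBLV ε) :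
    UrelementsFormSet M := by
  by_contra hA
  obtain ⟨s, hs⟩ := exists_forall_ext_eq hε
  obtain ⟨f, hf⟩ := exists_injOutside_omega hColl hACω hA s
  obtain ⟨f', hf'⟩ := exists_injOutside_omega hColl hACω hA (cup s (img (fun k => app f k) omega))
  obtain ⟨t, ht, het, htu⟩ := exists_trans_of_forall_transposition (s := s)
    (e := ε (tailClass f)) hA fun u w hu hw hus hws => by
      rw [hs _ (fun z hz _ => transposition_of_ne hu hw ?_ ?_), mapClass_transposition hf]
      · rintro rfl; exact hus hz
      · rintro rfl; exact hws hz
  set π := swap hf hf' with hπ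
  have hfix : π.Fixes s := swap_fixes hf hf'
  have he : π.ext (ε (tailClass f)) = ε (tailClass f) :=
    π.ext_eq_self ht (fun z hz hzu => hfix z (htu z hz hzu) hzu) het
  rw [hs π hfix] at he
  have hX := (hBLV _ _).1 he
  -- the range of `f` belongs to the class, but its image, the range of `f'`, does not
  have ha : img (fun k => app f k) omega ∈ (tailClass f).1 :=
    ⟨emp, emp_mem_omega, fun m hm _ => mem_img.2 ⟨m, hm, rfl⟩⟩
  obtain ⟨n, hn, h⟩ := mem_tailClass.1 (π.mem_mapClass.1 ((hX _).2 ha))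
  obtain ⟨y, hy, hny⟩ := (π.mem_ext_of_isSet (isSet_theSet _)).1 (h n hn (irrefl n))
  obtain ⟨k, hk, rfl⟩ := mem_img.1 hy
  rw [π.ext_of_isUr (hf k hk).1.1, hπ, swap_app hf hf' hk] at hny
  exact (hf' k hk).1.2 (mem_cup.2 (Or.inr (mem_img.2 ⟨n, hn, hny.symm⟩)))

end NoAbstraction

end UrelementSetTheory

theorem mainTheorem2 {M : Type u} [urLang.Structure M]
    (hZFUR : IsModelZFUR M) (hColl : Collection M) (hACω : CountableChoice M) :
    [UrelementsFormSet M,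
      ∃ ε : DefClass M → M, IsDefinableMap ε ∧ FulfillsBLV ε,
      ∃ ε : DefClass M → M, IsParamDefinableMap ε ∧ FulfillsBLV ε].TFAE := by
  have : ZFUR M := ⟨hZFUR⟩
  tfae_have 1 → 2 := exists_isDefinableMap
  tfae_have 2 → 3 := fun ⟨ε, hε, h⟩ => ⟨ε, hε.mono (Set.empty_subset _), h⟩
  tfae_have 3 → 1 := fun ⟨_, hε, h⟩ => urelementsFormSet_of_fulfillsBLV hColl hACω hε h
  tfae_finish
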